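/- Let $p\ge 1$, $q\ge 0$, $\nu>p$, $Q=\{1,\dots,q\}$. Let $V^p$ be either the unit ball $\mathbb B^p=\{\rho>0\}$ with $\rho(z)=1-|z|^2$ (put $\kappa=1$), or the Siegel domain $\mathbb U^p=\{\rho>0\}$ with $\rho(w)=\operatorname{Im}w_p-|w'|^2$ (put $\kappa=\tfrac14$). For $a>p$ let $d\mu_a=\kappa\frac{\Gamma(a)}{\pi^p\Gamma(a-p)}\rho^{a-p-1}dz$, let $H^2_a(V^p)$ be the space of holomorphic functions in $L^2(V^p,\mu_a)$, and let $P_a$ be the orthogonal projection onto $H_a^2(V^p)$. For a function $f$ on $V^p$, the Toeplitz operator $T_a^b(f)\psi=P_a(f\psi)$ is defined for those $\psi\in H^2_b(V^p)$ with $f\psi\in L^2(V^p,\mu_a)$. Let $\xi_1,\dots,\xi_q,\bar\xi_1,\dots,\bar\xi_q$ be anticommuting generators of a complex Grassmann algebra. For $I=\{i_1<\dots<i_k\}\subset Q$ put $\xi_I=\xi_{i_1}\cdots\xi_{i_k}$, $\xi_I^*=\bar\xi_{i_k}\cdots\bar\xi_{i_1}$, and define signs by $\xi_I\xi_J=\varepsilon_{I,J}\,\xi_{I\cup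 J}$ for disjoint $I,J$. For super functions $\Theta=\sum_M\theta_M\xi_M$ (with involution $\Theta^*=\sum_M\bar\theta_M\xi_M^*$) and $\Phi$ put $$(\Theta|\Phi)_\nu=\kappa\,\frac{\Gamma(\nu)}{\pi^p\Gamma(\nu+q-p)}\int dz\,d\xi\,\Bigl(\rho-\sum_i\xi_i\bar\xi_i\Bigr)^{\nu+q-p-1}\Theta^*\Phi ,$$ where the Berezin integral is normalized by $\int d\xi\,\xi_Q^*\xi_Q=1$. The super Bergman space $H^2_\nu(V^{p|q})$ consists of the $\Psi=\sum_M\psi_M\xi_M$ with holomorphic $\psi_M$ for which the integral $(\Psi|\Psi)_\nu$ converges. For a super function $F$, $T_F^\nu\Psi=P^\nu(F\Psi)$, with $P^\nu$ the orthogonal projection onto $H^2_\nu(V^{p|q})$; that is, $X=T_F^\nu\Psi$ means that $X\in H^2_\nu(V^{p|q})$ and, for all $\Theta\in H^2_\nu(V^{p|q})$, the integral $(\Theta|F\Psi)_\nu$ converges and equals $(\Theta|X)_\nu$. Then: (0) $\Psi=\sum_M\psi_M\xi_M$ belongs to $H^2_\nu(V^{p|q})$ if and only if $\psi_M\in H^2_{\nu+|M|}(V^p)$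 for all $M\subset Q$, and $(\Theta|\Psi)_\nu=\sum_M\frac{\Gamma(\nu)}{\Gamma(\nu+|M|)}\langle\theta_M,\psi_M\rangle_{\nu+|M|}$ on this space, where $\langle\theta,\psi\rangle_a=\int\bar\theta\,\psi\,d\mu_a$. (1) With respect to the decomposition $\Psi=\sum_M\psi_M\xi_M$, the operator $T_F^\nu$ with continuous coefficients is the $2^q\times2^q$ matrix $$(T_F^\nu)_{I,J}=\sum_{I\cup J\subset K\subset Q}\varepsilon_{K\setminus I,I}\,\varepsilon_{K\setminus J,J}\,\frac{\Gamma(\nu+|I|-p)}{\Gamma(\nu+|K|-p)}\,T_{\nu+|I|}^{\nu+|J|}\bigl(f_{I,J,K}\,\rho^{|K|-|I|}\bigr),$$ where $f_{I,J,K}=(-1)^{|K\setminus I|\,|K\setminus J|}F_{K\setminus J,K\setminus I}$ if $F=\sum_{A,B}F_{A,B}\,\xi_A\xi_B^*$, and $f_{I,J,K}=F_{K\setminus I,K\setminus J}$ if $F=\sum_{A,B}F_{A,B}\,\xi_A^*\xi_B$. (2) For $F=\sum_M F_M\,\xi_M\xi_M^*$ with continuous coefficients the matrix is diagonal, with the entries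 $$(T_F^\nu)_{I,I}=\sum_{I\subset K\subset Q}(-1)^{|K|-|I|}\,\frac{\Gamma(\nu+|I|-p)}{\Gamma(\nu+|K|-p)}\,T_{\nu+|I|}^{\nu+|I|}\bigl(F_{K\setminus I}\,\rho^{|K|-|I|}\bigr),$$ and the same holds without the sign $(-1)^{|K|-|I|}$ for $F=\sum_M F_M\,\xi_M^*\xi_M$. Here "is the matrix" means the following, where $c_{I,J,K}$ and $s_{I,J,K}$ are the coefficients and the symbols of the Toeplitz operators in the formula. For every $\Psi\in H^2_\nu(V^{p|q})$: (a) $T_F^\nu\Psi=\sum_I\chi_I\xi_I$ if and only if, for every $I$, $\chi_I\in H^2_{\nu+|I|}(V^p)$ and, for all $\theta\in H^2_{\nu+|I|}(V^p)$, the integral $\langle\theta,\sum_J\sum_K c_{I,J,K}s_{I,J,K}\psi_J\rangle_{\nu+|I|}$ converges and equals $\langle\theta,\chi_I\rangle_{\nu+|I|}$. (b) If each $\psi_J$ lies in the domain of every $T_{\nu+|I|}^{\nu+|J|}(s_{I,J,K})$ in the formula, then $T_F^\nu\Psi$ exists, is unique, and its $\xi_I$-component is $\sum_J\sum_K c_{I,J,K}\,T_{\nu+|I|}^{\nu+|J|}(s_{I,J,K})\,\psi_J$.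 -/

import Mathlib

open MeasureTheory
open scoped ComplexConjugate

noncomputable section

namespace SuperToeplitz

/-! ### The Grassmann algebra with generators `ξ₁, …, ξ_q, ξ̄₁, …, ξ̄_q` -/

/-- The complex Grassmann algebra on `2q` anticommuting generators: the summand `Sum.inl` carries
the generators `ξ i`, the summand `Sum.inr` carries the generators `ξ̄ i`. -/
abbrev Grassmann (q : ℕ) : Type := ExteriorAlgebra ℂ (Fin q ⊕ Fin q → ℂ)

/-- The generator `ξ i`. -/
def gen {q : ℕ} (i : Fin q) : Grassmann q := ExteriorAlgebra.ι ℂ (Pi.single (Sum.inl i) 1)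

/-- The generator `ξ̄ i`. -/
def genBar {q : ℕ} (i : Fin q) : Grassmann q := ExteriorAlgebra.ι ℂ (Pi.single (Sum.inr i) 1)

/-- `ξ_I = ξ_{i₁} ⋯ ξ_{i_k}` for `I = {i₁ < ⋯ < i_k}`. -/
def xi {q : ℕ} (I : Finset (Fin q)) : Grassmann q := ((I.sort (· ≤ ·)).map gen).prod

/-- `ξ_I^* = ξ̄_{i_k} ⋯ ξ̄_{i₁}` for `I = {i₁ < ⋯ < i_k}`. -/
def xiStar {q : ℕ} (I : Finset (Fin q)) : Grassmann q :=
  ((I.sort (· ≤ ·)).reverse.map genBar).prod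

/-- The sign `ε_{I,J}`, determined by `ξ_I ξ_J = ε_{I,J} ξ_{I ∪ J}` for disjoint `I`, `J`
(see `xi_mul_xi`): it counts the inversions between `I` and `J`. -/
def eps {q : ℕ} (I J : Finset (Fin q)) : ℂ :=
  (-1) ^ (((I ×ˢ J).filter fun x => x.2 < x.1).card)

lemma gen_mul_gen {q : ℕ} (i j : Fin q) : gen i * gen j = -(gen j * gen i) := by
  have h := ExteriorAlgebra.ι_add_mul_swap (R := ℂ)
    (Pi.single (Sum.inl i) 1 : Fin q ⊕ Fin q → ℂ) (Pi.single (Sum.inl j) 1)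
  exact eq_neg_of_add_eq_zero_left h

lemma xi_insert_min {q : ℕ} (a : Fin q) (s : Finset (Fin q)) (h : ∀ b ∈ s, a < b) :
    xi (insert a s) = gen a * xi s := by
  have ha : a ∉ s := fun hs => lt_irrefl _ (h a hs)
  unfold xi
  rw [Finset.sort_insert (r := (· ≤ ·)) (fun b hb => (h b hb).le) ha]
  simp

lemma gen_mul_xi {q : ℕ} (i : Fin q) (J : Finset (Fin q)) (hi : i ∉ J) :
    gen i * xi J = ((-1 : ℂ) ^ (J.filter fun j => j < i).card) • xi (insert i J) := by
  induction J using Finset.induction_on_min with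
  | empty => rw [xi_insert_min i ∅ (by simp)]; simp
  | insert a s hs ih =>
    have ha : a ∉ s := fun h => lt_irrefl _ (hs a h)
    simp only [Finset.mem_insert, not_or] at hi
    rcases lt_or_gt_of_ne hi.1 with h | h
    · have h' : ∀ b ∈ insert a s, i < b := by
        intro b hb
        rcases Finset.mem_insert.1 hb with rfl | hb
        · exact h
        · exact h.trans (hs b hb)
      rw [xi_insert_min i _ h', Finset.filter_eq_empty_iff.2 fun {b} hb => not_lt.2 (h' b hb).le]
      simp
    · have h' : ∀ b ∈ insert i s, a < b := by
        intro b hb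
        rcases Finset.mem_insert.1 hb with rfl | hb
        · exact h
        · exact hs b hb
      rw [xi_insert_min a s hs, ← mul_assoc, gen_mul_gen, neg_mul, mul_assoc, ih hi.2,
        Finset.insert_comm, xi_insert_min a _ h', Finset.filter_insert, if_pos h,
        Finset.card_insert_of_notMem (by simp [ha]), pow_succ, mul_smul_comm]
      simp

/-- The sign `eps` is the one that the products of the `ξ_I` define. -/
theorem xi_mul_xi {q : ℕ} (I J : Finset (Fin q)) (h : Disjoint I J) :
    xi I * xi J = eps I J • xi (I ∪ J) := by
  induction I using Finset.induction_on_min with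
  | empty => simp [xi, eps]
  | insert a s hs ih =>
    have ha : a ∉ s := fun h => lt_irrefl _ (hs a h)
    rw [Finset.disjoint_insert_left] at h
    have hcard : (((insert a s) ×ˢ J).filter fun x => x.2 < x.1).card
        = ((s ×ˢ J).filter fun x => x.2 < x.1).card + (J.filter fun j => j < a).card := by
      simp only [Finset.card_filter, Finset.sum_product]
      rw [Finset.sum_insert ha, add_comm]
    have hf : (s ∪ J).filter (fun j => j < a) = J.filter (fun j => j < a) := by
      rw [Finset.filter_union, Finset.filter_eq_empty_iff.2 fun {b} hb => not_lt.2 (hs b hb).le,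
        Finset.empty_union]
    rw [xi_insert_min a s hs, mul_assoc, ih h.2, mul_smul_comm,
      gen_mul_xi a _ (by simp [ha, h.1]), hf, smul_smul, Finset.insert_union]
    unfold eps
    rw [hcard, pow_add]

/-- The position of each generator in the list `ξ̄_q, …, ξ̄₁, ξ₁, …, ξ_q`. -/
def position (q : ℕ) : Fin q ⊕ Fin q ≃ Fin (q + q) :=
  (Equiv.sumComm _ _).trans
    ((Equiv.sumCongr Fin.revPerm (Equiv.refl (Fin q))).trans finSumFinEquiv)

/-- The odd part of the Berezin integral: the linear functional on the Grassmann algebra that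
takes the value `1` on `ξ_Q^* ξ_Q`, where `Q` is the set of all indices, and the value `0` on all
products of fewer than `2q` generators. -/
def berezin (q : ℕ) : Grassmann q →ₗ[ℂ] ℂ :=
  ExteriorAlgebra.liftAlternating fun m =>
    if h : q + q = m then
      (Matrix.detRowAlternating (n := Fin q ⊕ Fin q) (R := ℂ)).domDomCongr
        ((position q).trans (finCongr h))
    else 0

/-- The normalization `∫ ξ_Q^* ξ_Q = 1`. -/
theorem berezin_top (q : ℕ) : berezin q (xiStar Finset.univ * xi Finset.univ) = 1 := by
  have hsort : (Finset.univ : Finset (Fin q)).sort (· ≤ ·) = List.finRange q := by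
    apply List.Perm.eq_of_pairwise (le := (· ≤ ·))
    · intro a b _ _ h1 h2
      exact le_antisymm h1 h2
    · exact Finset.pairwise_sort _ _
    · exact (List.sortedLT_finRange q).pairwise.imp (fun h => le_of_lt h)
    · refine (List.perm_ext_iff_of_nodup (Finset.sort_nodup _ _) (List.nodup_finRange q)).2 ?_
      intro a
      simp
  have hprod : xiStar (q := q) Finset.univ * xi Finset.univ
      = ExteriorAlgebra.ιMulti ℂ (q + q)
          (fun k => (Pi.single ((position q).symm k) 1 : Fin q ⊕ Fin q → ℂ)) := by
    rw [ExteriorAlgebra.ιMulti_apply, List.ofFn_add, List.prod_append]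
    unfold xiStar xi
    rw [hsort, List.finRange_reverse, List.map_map, ← List.ofFn_eq_map, ← List.ofFn_eq_map]
    congr 3 <;> funext i
    · have h : (position q).symm (Fin.castAdd q i) = Sum.inr i.rev := by
        rw [Equiv.symm_apply_eq]
        simp [position]
      change genBar i.rev = ExteriorAlgebra.ι ℂ (Pi.single ((position q).symm (Fin.castAdd q i)) 1)
      rw [h, genBar]
    · have h : (position q).symm (Fin.natAdd q i) = Sum.inl i := by
        rw [Equiv.symm_apply_eq]
        simp [position]
      change gen i = ExteriorAlgebra.ι ℂ (Pi.single ((position q).symm (Fin.natAdd q i)) 1)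
      rw [h, gen]
  rw [hprod, berezin, ExteriorAlgebra.liftAlternating_apply_ιMulti, dif_pos rfl]
  have : (fun k => (Pi.single ((position q).symm k) 1 : Fin q ⊕ Fin q → ℂ)) ∘ position q
      = (1 : Matrix (Fin q ⊕ Fin q) (Fin q ⊕ Fin q) ℂ) := by
    funext i
    ext j
    simp [Matrix.one_apply, Pi.single_apply, eq_comm]
  have hdet : Matrix.detRowAlternating (1 : Matrix (Fin q ⊕ Fin q) (Fin q ⊕ Fin q) ℂ) = 1 :=
    Matrix.det_one
  rw [← this] at hdet
  exact hdet

/-! ### The unit ball and the Siegel domain in `ℂ^p`, where `p = n + 1` -/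

/-- The two domains under consideration: the unit ball `𝔹^p` and the Siegel domain `𝕌^p`. -/
inductive BaseDomain where
  | ball
  | siegel

/-- The defining function: `1 - |z|²` for the ball and `Im w_p - |w'|²` for the Siegel domain,
where `w = (w', w_p)`. -/
def BaseDomain.rho (V : BaseDomain) {n : ℕ} (z : Fin (n + 1) → ℂ) : ℝ :=
  match V with
  | .ball => 1 - ∑ i, ‖z i‖ ^ 2
  | .siegel => (z (Fin.last n)).im - ∑ i : Fin n, ‖z i.castSucc‖ ^ 2

/-- The domain itself, an open subset of `ℂ^p`. -/
def BaseDomain.carrier (V : BaseDomain) (n : ℕ) : Set (Fin (n + 1) → ℂ) := {z | 0 < V.rho z}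

/-- The factor by which the normalizing constants of the two domains differ. -/
def BaseDomain.kappa (V : BaseDomain) : ℝ :=
  match V with
  | .ball => 1
  | .siegel => 1 / 4

/-- The measure `κ Γ(ν) / (π^p Γ(ν - p)) ρ(z)^(ν - p - 1) dz` on the domain, `p = n + 1`, where
`dz` is the Lebesgue measure. -/
def bergmanMeasure (V : BaseDomain) (n : ℕ) (ν : ℝ) : Measure (Fin (n + 1) → ℂ) :=
  (volume.restrict (V.carrier n)).withDensity fun z => ENNReal.ofReal
    (V.kappa * Real.Gamma ν / (Real.pi ^ (n + 1) * Real.Gamma (ν - (n + 1))) *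
      V.rho z ^ (ν - (n + 1) - 1))

/-- The weighted Bergman space `H²_ν`: holomorphic functions on the domain that are square
integrable for `bergmanMeasure`. Only the values on the domain matter. -/
def MemBergman (V : BaseDomain) {n : ℕ} (ν : ℝ) (ψ : (Fin (n + 1) → ℂ) → ℂ) : Prop :=
  DifferentiableOn ℂ ψ (V.carrier n) ∧ MemLp ψ 2 (bergmanMeasure V n ν)

/-- The inner product of `L²(bergmanMeasure)`, conjugate linear in the first argument. -/
def bergmanInner (V : BaseDomain) {n : ℕ} (ν : ℝ) (θ ψ : (Fin (n + 1) → ℂ) → ℂ) : ℂ :=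
  ∫ z, conj (θ z) * ψ z ∂(bergmanMeasure V n ν)

/-- `h = P_ν φ`: the function `h` lies in the Bergman space `H²_ν`, and `φ - h` is orthogonal
to it. For `φ` in `L²` this is the orthogonal projection of `L²` onto `H²_ν`; the relation makes
sense as soon as the products of `φ` with the elements of `H²_ν` are integrable. -/
def IsBergmanProj (V : BaseDomain) {n : ℕ} (ν : ℝ) (φ h : (Fin (n + 1) → ℂ) → ℂ) : Prop :=
  MemBergman V ν h ∧ ∀ θ, MemBergman V ν θ →
    Integrable (fun z => conj (θ z) * φ z) (bergmanMeasure V n ν) ∧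
      bergmanInner V ν θ φ = bergmanInner V ν θ h

open Classical in
/-- The Bergman projection `P_ν φ` (with the value `0` if `φ` has no projection). -/
def bergmanProj (V : BaseDomain) {n : ℕ} (ν : ℝ) (φ : (Fin (n + 1) → ℂ) → ℂ) :
    (Fin (n + 1) → ℂ) → ℂ :=
  if h : ∃ g, IsBergmanProj V ν φ g then h.choose else 0

/-- The Bergman-type Toeplitz operator `T_a^b(f) ψ = P_a (f ψ)`, for `ψ` in `H²_b`
with `f ψ` in `L²(bergmanMeasure V n a)`. -/
def toeplitz (V : BaseDomain) {n : ℕ} (a : ℝ) (f ψ : (Fin (n + 1) → ℂ) → ℂ) :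
    (Fin (n + 1) → ℂ) → ℂ :=
  bergmanProj V a fun z => f z * ψ z

/-! ### Super functions and the super Bergman space -/

/-- The super-holomorphic function `∑_M ψ_M ξ_M`. -/
def superHol {n q : ℕ} (ψ : Finset (Fin q) → (Fin (n + 1) → ℂ) → ℂ) (z : Fin (n + 1) → ℂ) :
    Grassmann q :=
  ∑ M, ψ M z • xi M

/-- The image `∑_M conj ψ_M ξ_M^*` of `∑_M ψ_M ξ_M` under the involution of super functions. -/
def superHolStar {n q : ℕ} (ψ : Finset (Fin q) → (Fin (n + 1) → ℂ) → ℂ) (z : Fin (n + 1) → ℂ) :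
    Grassmann q :=
  ∑ M, conj (ψ M z) • xiStar M

/-- `(r + N)^α` for a real number `r > 0` and an even nilpotent element `N` with `N^(q+1) = 0`,
by the binomial series. -/
def superRpow {q : ℕ} (r : ℝ) (N : Grassmann q) (α : ℝ) : Grassmann q :=
  ∑ k ∈ Finset.range (q + 1),
    ((((∏ j ∈ Finset.range k, (α - j)) / (k.factorial : ℝ) * r ^ (α - k) : ℝ)) : ℂ) • N ^ k

/-- The weight `(ρ(z) - ξ ξ̄)^(ν + q - p - 1)` with `ξ ξ̄ = ∑ i, ξ_i ξ̄_i` and `p = n + 1`. -/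
def superWeight (V : BaseDomain) {n : ℕ} (q : ℕ) (ν : ℝ) (z : Fin (n + 1) → ℂ) : Grassmann q :=
  superRpow (V.rho z) (-∑ i, gen i * genBar i) (ν + q - (n + 1) - 1)

/-- The integrand, after integration over the odd variables, of the pairing `(Θ | Φ)_ν` of the
super-holomorphic function `Θ = ∑_M θ_M ξ_M` with a super function `Φ`. -/
def superDensity (V : BaseDomain) {n q : ℕ} (ν : ℝ) (θ : Finset (Fin q) → (Fin (n + 1) → ℂ) → ℂ)
    (Φ : (Fin (n + 1) → ℂ) → Grassmann q) (z : Fin (n + 1) → ℂ) : ℂ :=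
  berezin q (superWeight V q ν z * superHolStar θ z * Φ z)

/-- The pairing `(Θ | Φ)_ν = κ Γ(ν) / (π^p Γ(ν + q - p)) ∫ dz dξ (ρ - ξ ξ̄)^(ν+q-p-1) Θ^* Φ`. -/
def superInner (V : BaseDomain) {n q : ℕ} (ν : ℝ) (θ : Finset (Fin q) → (Fin (n + 1) → ℂ) → ℂ)
    (Φ : (Fin (n + 1) → ℂ) → Grassmann q) : ℂ :=
  ((V.kappa * Real.Gamma ν / (Real.pi ^ (n + 1) * Real.Gamma (ν + q - (n + 1))) : ℝ) : ℂ) *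
    ∫ z in V.carrier n, superDensity V ν θ Φ z

/-- The super Bergman space `H²_ν(V^{p|q})`: super-holomorphic functions `Ψ = ∑_M ψ_M ξ_M` for
which the integral `(Ψ | Ψ)_ν` converges. -/
def MemSuperBergman (V : BaseDomain) {n q : ℕ} (ν : ℝ)
    (ψ : Finset (Fin q) → (Fin (n + 1) → ℂ) → ℂ) : Prop :=
  (∀ M, DifferentiableOn ℂ (ψ M) (V.carrier n)) ∧
    IntegrableOn (superDensity V ν ψ (superHol ψ)) (V.carrier n)

/-- `X = P^ν Φ`, where `P^ν` is the orthogonal projection onto the super Bergman space: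
`X = ∑_M χ_M ξ_M` lies in `H²_ν(V^{p|q})`, and `Φ - X` is orthogonal to this space. -/
def IsSuperProj (V : BaseDomain) {n q : ℕ} (ν : ℝ) (Φ : (Fin (n + 1) → ℂ) → Grassmann q)
    (χ : Finset (Fin q) → (Fin (n + 1) → ℂ) → ℂ) : Prop :=
  MemSuperBergman V ν χ ∧ ∀ θ, MemSuperBergman V ν θ →
    IntegrableOn (superDensity V ν θ Φ) (V.carrier n) ∧
      superInner V ν θ Φ = superInner V ν θ (superHol χ)

/-- `X = T_F^ν Ψ = P^ν (F Ψ)`, for a super function `F` and `Ψ = ∑_M ψ_M ξ_M`,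
`X = ∑_M χ_M ξ_M`. -/
def IsSuperToeplitz (V : BaseDomain) {n q : ℕ} (ν : ℝ) (F : (Fin (n + 1) → ℂ) → Grassmann q)
    (ψ χ : Finset (Fin q) → (Fin (n + 1) → ℂ) → ℂ) : Prop :=
  IsSuperProj V ν (fun z => F z * superHol ψ z) χ

/-- With respect to the decomposition `Ψ = ∑_M ψ_M ξ_M`, the super Toeplitz operator `T_F^ν` is the
matrix with the entries `(T_F^ν)_{I,J} = ∑_{K ∈ S I J} c I J K • T_{ν+|I|}^{ν+|J|} (s I J K)`.

* First part: for all `Ψ` in the super Bergman space, `T_F^ν Ψ = X` holds if and only if, for all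
  `I`, the function `χ_I` is the projection of `∑_J ∑_K c s ψ_J` to `H²_{ν+|I|}`.
* Second part: if the `ψ_J` are in the domains of all the Toeplitz operators `T (s I J K)`, i.e.
  the functions `s I J K ψ_J` are in the `L²` space of weight `ν + |I|`, then all these operators
  are defined at `ψ_J`, and `T_F^ν Ψ` is defined and given by the matrix. -/
def HasToeplitzMatrix (V : BaseDomain) {n q : ℕ} (ν : ℝ) (F : (Fin (n + 1) → ℂ) → Grassmann q)
    (S : Finset (Fin q) → Finset (Fin q) → Finset (Finset (Fin q)))
    (c : Finset (Fin q) → Finset (Fin q) → Finset (Fin q) → ℂ)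
    (s : Finset (Fin q) → Finset (Fin q) → Finset (Fin q) → (Fin (n + 1) → ℂ) → ℂ) : Prop :=
  ∀ ψ : Finset (Fin q) → (Fin (n + 1) → ℂ) → ℂ, MemSuperBergman V ν ψ →
    (∀ χ : Finset (Fin q) → (Fin (n + 1) → ℂ) → ℂ,
      IsSuperToeplitz V ν F ψ χ ↔ ∀ I, IsBergmanProj V (ν + I.card)
        (fun z => ∑ J, ∑ K ∈ S I J, c I J K * (s I J K z * ψ J z)) (χ I)) ∧
    ((∀ I J, ∀ K ∈ S I J,
        MemLp (fun z => s I J K z * ψ J z) 2 (bergmanMeasure V n (ν + I.card))) →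
      (∀ I J, ∀ K ∈ S I J, IsBergmanProj V (ν + I.card) (fun z => s I J K z * ψ J z)
        (toeplitz V (ν + I.card) (s I J K) (ψ J))) ∧
      IsSuperToeplitz V ν F ψ (fun I z =>
        ∑ J, ∑ K ∈ S I J, c I J K * toeplitz V (ν + I.card) (s I J K) (ψ J) z) ∧
      ∀ χ : Finset (Fin q) → (Fin (n + 1) → ℂ) → ℂ, IsSuperToeplitz V ν F ψ χ →
        ∀ I, ∀ z ∈ V.carrier n, χ I z =
          ∑ J, ∑ K ∈ S I J, c I J K * toeplitz V (ν + I.card) (s I J K) (ψ J) z)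

end SuperToeplitz

end

open SuperToeplitz

/-! The odd variables can be integrated out explicitly. Since `-ξ_i ξ̄_i = ξ̄_i ξ_i` and these even
elements commute and square to zero, the k-th power of their sum is `k!` times the sum of `ξ_S^*
ξ_S` over `|S| = k` (`sum_pair_pow`). The Berezin integral of `ξ_S^* ξ_S ξ_A^* ξ_B` vanishes unless
`A = B` is the complement of `S`. So a single term of the binomial series survives, and the weight
integrates against `ξ_A^* ξ_B` to zero for `A ≠ B` and to a multiple of `ρ^(ν+|A|-p-1)` for `A = B`
(`berezin_superWeight`). Up to the factor `Γ(ν)/Γ(ν+|A|)` this is the weight of `H²_{ν+|A|}`, whence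
the orthogonal decomposition.

In `(Θ | F Ψ)_ν`, the product `ξ_I^* ξ_A^* ξ_B ξ_J` contributes only if `A ∪ I = B ∪ J =: K` with
disjoint unions, so `A = K \ I` and `B = K \ J`. Rewriting the weight of `K` through that of `I`
produces the Gamma quotient and the power `ρ^(|K|-|I|)` (`superConst_mul_componentWeight`). Testing
against one component at a time splits the super projection into Bergman projections
(`HasComponents.isSuperProj_iff`).

Existence and uniqueness of the projections rest on the mean value property: it bounds point
evaluations locally uniformly, so the holomorphic classes are closed in `L²`. -/

namespace SuperToeplitz

/-! ### Monomials in the Grassmann algebra -/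

variable {q : ℕ}

lemma gen_mul_self (i : Fin q) : gen i * gen i = 0 := ExteriorAlgebra.ι_sq_zero _

lemma gen_mul_genBar (i j : Fin q) : gen i * genBar j = -(genBar j * gen i) :=
  eq_neg_of_add_eq_zero_left (ExteriorAlgebra.ι_add_mul_swap (R := ℂ) _ _)

lemma genBar_mul_genBar (i j : Fin q) : genBar i * genBar j = -(genBar j * genBar i) :=
  eq_neg_of_add_eq_zero_left (ExteriorAlgebra.ι_add_mul_swap (R := ℂ) _ _)

lemma xi_empty : xi (∅ : Finset (Fin q)) = 1 := by simp [xi]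

lemma xiStar_empty : xiStar (∅ : Finset (Fin q)) = 1 := by simp [xiStar]

lemma xi_singleton (i : Fin q) : xi {i} = gen i := by simp [xi]

lemma xiStar_singleton (i : Fin q) : xiStar {i} = genBar i := by simp [xiStar]

lemma eps_mul_self (I J : Finset (Fin q)) : eps I J * eps I J = 1 := by
  rw [eps, ← mul_pow]; simp

lemma eps_ne_zero (I J : Finset (Fin q)) : eps I J ≠ 0 :=
  left_ne_zero_of_mul_eq_one (eps_mul_self I J)

/-- The linear antiautomorphism of the Grassmann algebra that exchanges `ξ i` and `ξ̄ i`. -/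
def starMap (q : ℕ) : Grassmann q →ₗ[ℂ] Grassmann q :=
  (CliffordAlgebra.reverse (Q := (0 : QuadraticForm ℂ (Fin q ⊕ Fin q → ℂ)))).comp
    (ExteriorAlgebra.map (LinearMap.funLeft ℂ ℂ (Sum.swap : Fin q ⊕ Fin q → _))).toLinearMap

lemma starMap_mul (x y : Grassmann q) : starMap q (x * y) = starMap q y * starMap q x := by
  simp only [starMap, LinearMap.comp_apply, AlgHom.toLinearMap_apply, map_mul]
  exact CliffordAlgebra.reverse.map_mul _ _

lemma starMap_one : starMap q 1 = 1 := by
  simp only [starMap, LinearMap.comp_apply, AlgHom.toLinearMap_apply, map_one]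
  exact CliffordAlgebra.reverse.map_one

lemma starMap_gen (i : Fin q) : starMap q (gen i) = genBar i := by
  simp only [starMap, LinearMap.comp_apply, AlgHom.toLinearMap_apply, gen, genBar,
    ExteriorAlgebra.map_apply_ι]
  refine (CliffordAlgebra.reverse_ι _).trans (congrArg _ ?_)
  ext x
  rcases x with x | x <;> simp [LinearMap.funLeft_apply, Pi.single_apply]

lemma starMap_list (l : List (Fin q)) :
    starMap q (l.map gen).prod = (l.reverse.map genBar).prod := by
  induction l with
  | nil => simp [starMap_one]
  | cons a l ih => simp [starMap_mul, starMap_gen, ih]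

/-- This transfers product formulas from `ξ_I` to `ξ_I^*` with the factors reversed. A linear map
suffices because the conjugation of coefficients is already part of `superHolStar`. -/
lemma starMap_xi (I : Finset (Fin q)) : starMap q (xi I) = xiStar I := starMap_list _

/-- Up to signs, a common generator can be moved to the right end of `ξ_I` and to the left end of
`ξ_J`, where its square appears. -/
lemma xi_mul_xi_eq_zero (I J : Finset (Fin q)) (h : ¬ Disjoint I J) : xi I * xi J = 0 := by
  obtain ⟨i, hI, hJ⟩ := Finset.not_disjoint_iff.1 h
  have h1 := xi_mul_xi (I.erase i) {i} (by simp)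
  have h2 := xi_mul_xi {i} (J.erase i) (by simp)
  have e1 : I.erase i ∪ {i} = I := by
    rw [Finset.union_comm, ← Finset.insert_eq, Finset.insert_erase hI]
  rw [e1] at h1
  rw [← Finset.insert_eq, Finset.insert_erase hJ] at h2
  rw [xi_singleton] at h1 h2
  have h3 : (eps (I.erase i) {i} * eps {i} (J.erase i)) • (xi I * xi J) = 0 := by
    rw [← smul_mul_smul_comm, ← h1, ← h2, mul_assoc, ← mul_assoc (gen i), gen_mul_self]
    simp
  exact (smul_eq_zero.1 h3).resolve_left (mul_ne_zero (eps_ne_zero _ _) (eps_ne_zero _ _))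

lemma xi_mul_xi' (I J : Finset (Fin q)) :
    xi I * xi J = if Disjoint I J then eps I J • xi (I ∪ J) else 0 := by
  split_ifs with h
  · exact xi_mul_xi I J h
  · exact xi_mul_xi_eq_zero I J h

lemma xiStar_mul_xiStar (I J : Finset (Fin q)) :
    xiStar I * xiStar J = if Disjoint J I then eps J I • xiStar (J ∪ I) else 0 := by
  rw [← starMap_xi, ← starMap_xi, ← starMap_mul, xi_mul_xi']
  split_ifs with h
  · rw [map_smul, starMap_xi]
  · exact map_zero _

lemma gen_mul_xiStar (i : Fin q) (B : Finset (Fin q)) :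
    gen i * xiStar B = (-1 : ℂ) ^ B.card • (xiStar B * gen i) := by
  rw [xiStar, ← Finset.length_sort (· ≤ ·), ← List.length_reverse]
  generalize (B.sort (· ≤ ·)).reverse = l
  induction l with
  | nil => simp
  | cons a l ih =>
    rw [List.map_cons, List.prod_cons, ← mul_assoc, gen_mul_genBar, neg_mul, mul_assoc, ih,
      List.length_cons, pow_succ, mul_smul_comm, mul_assoc]
    simp

/-- Each of the `|A|` generators passes `|B|` others. This is the source of the sign `(-1)^(|K \ I|
|K \ J|)`. -/
lemma xi_mul_xiStar (A B : Finset (Fin q)) :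
    xi A * xiStar B = (-1 : ℂ) ^ (A.card * B.card) • (xiStar B * xi A) := by
  induction A using Finset.induction_on_min with
  | empty => simp [xi_empty]
  | insert a s hs ih =>
    have ha : a ∉ s := fun h => lt_irrefl _ (hs a h)
    rw [xi_insert_min a s hs, mul_assoc, ih, mul_smul_comm, ← mul_assoc, gen_mul_xiStar,
      Finset.card_insert_of_notMem ha, add_mul, one_mul, pow_add, smul_mul_assoc, smul_smul,
      mul_assoc]

/-- The even element `ξ̄_i ξ_i`. -/
def pair (i : Fin q) : Grassmann q := genBar i * gen i

lemma pair_comm_genBar (i j : Fin q) : Commute (pair i) (genBar j) := by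
  rw [Commute, SemiconjBy, pair, mul_assoc, gen_mul_genBar, mul_neg, ← mul_assoc,
    genBar_mul_genBar, neg_mul, neg_neg, mul_assoc]

lemma pair_comm_xiStar (i : Fin q) (S : Finset (Fin q)) : Commute (pair i) (xiStar S) := by
  refine Commute.list_prod_right _ _ fun x hx => ?_
  obtain ⟨j, -, rfl⟩ := List.mem_map.1 hx
  exact pair_comm_genBar i j

lemma pair_mul_self (i : Fin q) : pair i * pair i = 0 := by
  rw [pair, mul_assoc, ← mul_assoc (gen i), gen_mul_genBar, neg_mul, mul_assoc, gen_mul_self]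
  simp

/-- No sign appears: `eps {i} S` arises once from the `ξ` and once from the `ξ̄`, and squares to
one. -/
lemma pair_mul_of_notMem (i : Fin q) (S : Finset (Fin q)) (h : i ∉ S) :
    pair i * (xiStar S * xi S) = xiStar (insert i S) * xi (insert i S) := by
  have hd : Disjoint {i} S := by simpa using h
  have h1 := xi_mul_xi {i} S hd
  have h2 := xiStar_mul_xiStar S {i}
  rw [if_pos hd, ← Finset.insert_eq, xiStar_singleton] at h2
  rw [← Finset.insert_eq, xi_singleton] at h1
  have h3 : xiStar (insert i S) * xi (insert i S) =
      (eps {i} S • xiStar (insert i S)) * (eps {i} S • xi (insert i S)) := by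
    rw [smul_mul_smul_comm, eps_mul_self, one_smul]
  rw [h3, ← h1, ← h2, ← mul_assoc, (pair_comm_xiStar i S).eq, pair]
  simp only [mul_assoc]

lemma pair_mul_of_mem (i : Fin q) (S : Finset (Fin q)) (h : i ∈ S) :
    pair i * (xiStar S * xi S) = 0 := by
  rw [← Finset.insert_erase h, ← pair_mul_of_notMem i _ (by simp), ← mul_assoc, pair_mul_self,
    zero_mul]

lemma xiStar_mul_xi_mul (S T : Finset (Fin q)) (h : Disjoint S T) :
    (xiStar S * xi S) * (xiStar T * xi T) = xiStar (S ∪ T) * xi (S ∪ T) := by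
  induction S using Finset.induction_on with
  | empty => simp [xi_empty, xiStar_empty]
  | insert a s ha ih =>
    rw [Finset.disjoint_insert_left] at h
    rw [← pair_mul_of_notMem a s ha, mul_assoc, ih h.2,
      pair_mul_of_notMem a _ (by simp [ha, h.1]), Finset.insert_union]

/-- Multinomial expansion for commuting elements of square zero: each `S` with `k` elements arises
from its `k!` orderings. -/
lemma sum_pair_pow (k : ℕ) :
    (∑ i : Fin q, pair i) ^ k =
      (k.factorial : ℂ) • ∑ S ∈ Finset.powersetCard k Finset.univ, xiStar S * xi S := by
  induction k with
  | zero => simp [xi_empty, xiStar_empty]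
  | succ k ih =>
    have key : (∑ i : Fin q, pair i) *
        (∑ S ∈ Finset.powersetCard k Finset.univ, xiStar S * xi S) =
        ((k + 1 : ℕ) : ℂ) • ∑ S ∈ Finset.powersetCard (k + 1) Finset.univ,
          (xiStar S * xi S : Grassmann q) := by
      have h1 : ∀ T ∈ Finset.powersetCard (k + 1) (Finset.univ : Finset (Fin q)),
          ((k + 1 : ℕ) : ℂ) • (xiStar T * xi T) = ∑ i ∈ T, xiStar T * xi T := by
        intro T hT
        rw [Finset.sum_const, (Finset.mem_powersetCard.1 hT).2, Nat.cast_smul_eq_nsmul]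
      have h2 : ∀ S ∈ Finset.powersetCard k (Finset.univ : Finset (Fin q)),
          (∑ i : Fin q, pair i * (xiStar S * xi S)) =
            ∑ i ∈ Sᶜ, xiStar (insert i S) * xi (insert i S) := by
        intro S _
        rw [← Finset.sum_subset (Finset.subset_univ Sᶜ)]
        · exact Finset.sum_congr rfl fun i hi => pair_mul_of_notMem i S (by simpa using hi)
        · exact fun i _ hi => pair_mul_of_mem i S (by simpa using hi)
      rw [Finset.sum_mul_sum, Finset.sum_comm, Finset.sum_congr rfl h2, Finset.smul_sum,
        Finset.sum_congr rfl h1, Finset.sum_sigma', Finset.sum_sigma']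
      -- A set `T` of size `k + 1` arises from the `k + 1` choices of the element `i ∈ T` inserted
      -- last.
      refine Finset.sum_bij' (fun x _ => ⟨insert x.2 x.1, x.2⟩)
        (fun x _ => ⟨x.1.erase x.2, x.2⟩) ?_ ?_ ?_ ?_ ?_
      · rintro ⟨S, i⟩ h
        simp only [Finset.mem_sigma, Finset.mem_powersetCard, Finset.subset_univ, true_and,
          Finset.mem_compl] at h
        simp [Finset.mem_powersetCard, Finset.card_insert_of_notMem h.2, h.1]
      · rintro ⟨S, i⟩ h
        simp only [Finset.mem_sigma, Finset.mem_powersetCard, Finset.subset_univ, true_and] at h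
        simp [Finset.mem_powersetCard, Finset.card_erase_of_mem h.2, h.1]
      · rintro ⟨S, i⟩ h
        simp only [Finset.mem_sigma, Finset.mem_compl] at h
        simp [Finset.erase_insert h.2]
      · rintro ⟨S, i⟩ h
        simp only [Finset.mem_sigma] at h
        simp [Finset.insert_erase h.2]
      · rintro ⟨S, i⟩ h
        rfl
    rw [pow_succ', ih, mul_smul_comm, key, smul_smul, Nat.factorial_succ, Nat.cast_mul, mul_comm]

/-! ### The Berezin integral of the weight -/

/-- For words of length `2q` the integral is the determinant of a matrix whose rows are unit
vectors; a missing generator leaves a zero column. Other lengths give zero by definition. -/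
lemma berezin_list (L : List (Fin q ⊕ Fin q))
    (h : ¬ (L.length = q + q ∧ ∀ x, x ∈ L)) :
    berezin q (L.map fun x => ExteriorAlgebra.ι ℂ (Pi.single x 1)).prod = 0 := by
  have hprod : (L.map fun x =>
      ExteriorAlgebra.ι ℂ (Pi.single x 1 : Fin q ⊕ Fin q → ℂ)).prod =
      ExteriorAlgebra.ιMulti ℂ L.length
        (fun k => (Pi.single (L.get k) 1 : Fin q ⊕ Fin q → ℂ)) := by
    rw [ExteriorAlgebra.ιMulti_apply]
    conv_lhs => rw [← List.ofFn_get L, List.map_ofFn]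
    rfl
  rw [hprod, berezin, ExteriorAlgebra.liftAlternating_apply_ιMulti]
  by_cases hl : q + q = L.length
  · rw [dif_pos hl]
    push Not at h
    obtain ⟨x, hx⟩ := h hl.symm
    refine Matrix.det_eq_zero_of_column_eq_zero x fun i => ?_
    refine Pi.single_eq_of_ne ?_ _
    rintro rfl
    exact hx (List.get_mem _ _)
  · rw [dif_neg hl]
    rfl

lemma berezin_pairs_mul (S A B : Finset (Fin q)) :
    berezin q ((xiStar S * xi S) * (xiStar A * xi B)) = if A = Sᶜ ∧ B = Sᶜ then 1 else 0 := by
  split_ifs with h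
  · rw [h.1, h.2, xiStar_mul_xi_mul S _ disjoint_compl_right, Finset.union_compl, berezin_top]
  · let l : Finset (Fin q) → List (Fin q) := fun S => S.sort (· ≤ ·)
    have hp : (xiStar S * xi S) * (xiStar A * xi B) =
        (((l S).reverse.map Sum.inr ++ (l S).map Sum.inl ++
          ((l A).reverse.map Sum.inr ++ (l B).map Sum.inl)).map fun x =>
            ExteriorAlgebra.ι ℂ (Pi.single x 1 : Fin q ⊕ Fin q → ℂ)).prod := by
      simp only [List.map_append, List.prod_append, List.map_map]
      rfl
    rw [hp]
    refine berezin_list _ fun h' => h ?_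
    obtain ⟨h1, h2⟩ := h'
    simp only [List.length_append, List.length_map, List.length_reverse, l,
      Finset.length_sort] at h1
    have hA : Sᶜ ⊆ A := by
      intro i hi
      have := h2 (Sum.inr i)
      simp only [List.mem_append, List.mem_map, List.mem_reverse, l, Finset.mem_sort] at this
      simp at this hi
      tauto
    have hB : Sᶜ ⊆ B := by
      intro i hi
      have := h2 (Sum.inl i)
      simp only [List.mem_append, List.mem_map, List.mem_reverse, l, Finset.mem_sort] at this
      simp at this hi
      tauto
    -- The word has `2|S| + |A| + |B| = 2q` letters, so both inclusions of `Sᶜ` must be equalities.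
    have c1 := Finset.card_le_card hA
    have c2 := Finset.card_le_card hB
    have c3 := Finset.card_add_card_compl S
    rw [Fintype.card_fin] at c3
    exact ⟨(Finset.eq_of_subset_of_card_le hA (by omega)).symm,
      (Finset.eq_of_subset_of_card_le hB (by omega)).symm⟩

lemma berezin_sum_pair_pow (k : ℕ) (A B : Finset (Fin q)) :
    berezin q ((∑ i : Fin q, pair i) ^ k * (xiStar A * xi B)) =
      if A = B ∧ k = Aᶜ.card then (k.factorial : ℂ) else 0 := by
  rw [sum_pair_pow, smul_mul_assoc, map_smul, Finset.sum_mul, map_sum]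
  simp only [berezin_pairs_mul]
  split_ifs with h
  · obtain ⟨rfl, rfl⟩ := h
    rw [Finset.sum_eq_single Aᶜ]
    · simp
    · intro S _ hS
      exact if_neg fun h => hS (by rw [h.1, compl_compl])
    · intro h
      simp [Finset.mem_powersetCard] at h
  · rw [Finset.sum_eq_zero, smul_zero]
    intro S hS
    refine if_neg fun h' => h ⟨h'.1.trans h'.2.symm, ?_⟩
    rw [h'.1, compl_compl, (Finset.mem_powersetCard.1 hS).2]

lemma prod_sub_eq_Gamma_div (α : ℝ) (k : ℕ) (h : 0 < α + 1 - k) :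
    ∏ j ∈ Finset.range k, (α - j) = Real.Gamma (α + 1) / Real.Gamma (α + 1 - k) := by
  induction k with
  | zero =>
    have : Real.Gamma (α + 1) ≠ 0 := (Real.Gamma_pos_of_pos (by simpa using h)).ne'
    simp [this]
  | succ k ih =>
    push_cast at h ⊢
    have hk : 0 < α - k := by linarith
    rw [Finset.prod_range_succ, ih (by linarith), show α + 1 - (k + 1 : ℝ) = α - k by ring,
      show α + 1 - k = (α - k) + 1 by ring, Real.Gamma_add_one hk.ne']
    have := (Real.Gamma_pos_of_pos hk).ne'
    field_simp

/-- Only the term `k = |Aᶜ|` of the binomial series has the right degree. Its denominator `k!`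
cancels against the factor from `sum_pair_pow`, and the falling factorial is a quotient of Gamma
values. -/
lemma berezin_superRpow (r α : ℝ) (A B : Finset (Fin q)) (h : 0 < α + 1 - (Aᶜ.card : ℝ)) :
    berezin q (superRpow r (-∑ i, gen i * genBar i) α * (xiStar A * xi B)) =
      if A = B then
        ((Real.Gamma (α + 1) / Real.Gamma (α + 1 - Aᶜ.card) * r ^ (α - Aᶜ.card) : ℝ) : ℂ)
      else 0 := by
  have hN : (-∑ i : Fin q, gen i * genBar i) = ∑ i, pair i := by
    rw [← Finset.sum_neg_distrib]
    exact Finset.sum_congr rfl fun i _ => by rw [gen_mul_genBar, neg_neg, pair]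
  have hc : Aᶜ.card < q + 1 := by
    have := Finset.card_le_univ Aᶜ
    rw [Fintype.card_fin] at this
    omega
  rw [superRpow, hN, Finset.sum_mul, map_sum]
  simp only [smul_mul_assoc, map_smul, berezin_sum_pair_pow, smul_eq_mul]
  rw [Finset.sum_eq_single Aᶜ.card]
  · by_cases hAB : A = B
    · rw [if_pos ⟨hAB, rfl⟩, if_pos hAB, prod_sub_eq_Gamma_div _ _ h]
      have : (Aᶜ.card.factorial : ℂ) ≠ 0 := by exact_mod_cast Nat.factorial_ne_zero _
      push_cast
      field_simp
    · rw [if_neg fun h => hAB h.1, if_neg hAB, mul_zero]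
  · intro k _ hk
    rw [if_neg fun h => hk h.2, mul_zero]
  · intro h
    exact absurd (Finset.mem_range.2 hc) h

end SuperToeplitz

namespace SuperToeplitz

open Filter Metric Topology

/-! ### Mean values and limits of holomorphic functions of several variables -/

section Holomorphic

variable {ι : Type*} [Fintype ι]

lemma measurePreserving_smul_of_norm_eq_one (c : ℂ) (hc : ‖c‖ = 1) :
    MeasurePreserving (fun u : ι → ℂ => c • u) := by
  have h := volume_preserving_pi (fun _ : ι =>
    (rotation (⟨c, by simpa [Submonoid.unitSphere] using hc⟩ : Circle)).measurePreserving)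
  exact h

/-- The mean value property of holomorphic functions of several variables. -/
lemma setIntegral_closedBall_add (f : (ι → ℂ) → ℂ) (z : ι → ℂ) {r : ℝ}
    {U : Set (ι → ℂ)} (hf : DifferentiableOn ℂ f U) (hz : closedBall z r ⊆ U) :
    ∫ u in closedBall (0 : ι → ℂ) r, f (z + u) =
      (volume.real (closedBall (0 : ι → ℂ) r) : ℂ) * f z := by
  set B := closedBall (0 : ι → ℂ) r with hB
  have hcU : ∀ c : ℂ, ‖c‖ ≤ 1 → ∀ u ∈ B, z + c • u ∈ U := by
    intro c hc u hu
    apply hz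
    rw [mem_closedBall, dist_self_add_left, norm_smul]
    rw [hB, mem_closedBall_zero_iff] at hu
    nlinarith [norm_nonneg u, norm_nonneg c]
  -- One-variable mean value property on the disc `c ↦ z + c • u`. Integrating over `u` and
  -- exchanging the integrals leaves an inner integral that does not depend on the angle, by
  -- rotation invariance of the ball and of the volume.
  have hmean : ∀ u ∈ B, f z = (2 * Real.pi)⁻¹ •
      ∫ t in (0 : ℝ)..2 * Real.pi, f (z + circleMap 0 1 t • u) := by
    intro u hu
    have h1 : DifferentiableOn ℂ (fun c : ℂ => f (z + c • u)) (closedBall 0 1) := by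
      refine hf.comp (t := U) (by fun_prop) fun c hc => hcU c ?_ u hu
      simpa using hc
    have h2 : DiffContOnCl ℂ (fun c : ℂ => f (z + c • u)) (ball 0 |1|) := by
      rw [abs_one]
      exact ⟨h1.mono ball_subset_closedBall,
        by rw [closure_ball _ one_ne_zero]; exact h1.continuousOn⟩
    simpa [Real.circleAverage_def] using h2.circleAverage.symm
  have hrot : ∀ t : ℝ, ∫ u in B, f (z + circleMap 0 1 t • u) = ∫ u in B, f (z + u) := by
    intro t
    have hc : ‖circleMap 0 1 t‖ = 1 := by simp
    have hc0 : circleMap 0 1 t ≠ 0 := by rw [← norm_ne_zero_iff, hc]; exact one_ne_zero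
    have h := (measurePreserving_smul_of_norm_eq_one (ι := ι) _ hc).setIntegral_preimage_emb
      (MeasurableEquiv.smul₀ (circleMap 0 1 t) hc0).measurableEmbedding (fun u => f (z + u)) B
    have hpre : (fun u : ι → ℂ => circleMap 0 1 t • u) ⁻¹' B = B := by
      ext u
      simp only [hB, Set.mem_preimage, mem_closedBall_zero_iff, norm_smul, hc, one_mul]
    rw [hpre] at h
    exact h
  have hint : Integrable (Function.uncurry fun (t : ℝ) (u : ι → ℂ) =>
      f (z + circleMap 0 1 t • u))
      ((volume.restrict (Set.uIoc 0 (2 * Real.pi))).prod (volume.restrict B)) := by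
    rw [Measure.prod_restrict]
    have hcont : ContinuousOn (Function.uncurry fun (t : ℝ) (u : ι → ℂ) =>
        f (z + circleMap 0 1 t • u)) (Set.Icc 0 (2 * Real.pi) ×ˢ B) := by
      refine hf.continuousOn.comp (Continuous.continuousOn ?_) fun x hx => hcU _ (by simp) _ hx.2
      have := continuous_circleMap 0 1
      fun_prop
    refine IntegrableOn.mono_set (hcont.integrableOn_compact
      (isCompact_Icc.prod (isCompact_closedBall _ _))) (Set.prod_mono ?_ subset_rfl)
    rw [Set.uIoc_of_le Real.two_pi_pos.le]
    exact Set.Ioc_subset_Icc_self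
  have hvol : ∫ _u in B, f z = (volume.real B : ℂ) * f z := by
    rw [setIntegral_const, Complex.real_smul]
  rw [← hvol, setIntegral_congr_fun measurableSet_closedBall hmean, integral_smul,
    ← intervalIntegral_integral_swap hint]
  simp only [hrot, intervalIntegral.integral_const, sub_zero, smul_smul]
  rw [inv_mul_cancel₀ Real.two_pi_pos.ne', one_smul]

/-- The mean value property is applied to the holomorphic function `f ^ 2`, with the norm taken
inside the integral. -/
lemma norm_sq_mul_le_setIntegral (f : (ι → ℂ) → ℂ) (z : ι → ℂ) {r : ℝ}
    {U : Set (ι → ℂ)} (hf : DifferentiableOn ℂ f U) (hz : closedBall z r ⊆ U) :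
    volume.real (closedBall (0 : ι → ℂ) r) * ‖f z‖ ^ 2 ≤ ∫ u in closedBall z r, ‖f u‖ ^ 2 := by
  have h := setIntegral_closedBall_add (fun u => f u ^ 2) z (hf.pow 2) hz
  have h1 : ∫ u in closedBall z r, ‖f u‖ ^ 2 =
      ∫ u in closedBall (0 : ι → ℂ) r, ‖f (z + u) ^ 2‖ := by
    rw [← (measurePreserving_add_left volume z).setIntegral_preimage_emb
      (measurableEmbedding_addLeft z)]
    have : (z + ·) ⁻¹' closedBall z r = closedBall (0 : ι → ℂ) r := by
      ext u; simp
    rw [this]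
    simp
  rw [h1]
  calc _ = ‖(volume.real (closedBall (0 : ι → ℂ) r) : ℂ) * f z ^ 2‖ := by
        rw [norm_mul, norm_pow, Complex.norm_real, Real.norm_of_nonneg measureReal_nonneg]
    _ ≤ _ := by
        rw [← h]
        exact norm_integral_le_integral_norm _

end Holomorphic

/-- A locally uniform limit of holomorphic functions on a normed space is holomorphic. -/
lemma differentiableAt_of_uniformCauchySeqOn {E : Type*} [NormedAddCommGroup E]
    [NormedSpace ℂ E] {f : ℕ → E → ℂ} {g : E → ℂ} {z : E} {r : ℝ} (hr : 0 < r)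
    (hf : ∀ k, DifferentiableOn ℂ (f k) (ball z (2 * r)))
    (h : UniformCauchySeqOn f atTop (ball z (2 * r)))
    (hg : ∀ x ∈ ball z (2 * r), Tendsto (fun k => f k x) atTop (𝓝 (g x))) :
    DifferentiableAt ℂ g z := by
  have hsub : ∀ x ∈ ball z r, ball x r ⊆ ball z (2 * r) := fun x hx =>
    ball_subset_ball' (by rw [mem_ball] at hx; linarith)
  have hself : ball z r ⊆ ball z (2 * r) := ball_subset_ball (by linarith)
  have hdiff : ∀ k, ∀ x ∈ ball z r, DifferentiableAt ℂ (f k) x := fun k x hx =>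
    (hf k).differentiableAt (isOpen_ball.mem_nhds (hself hx))
  have hC : UniformCauchySeqOn (fun k => fderiv ℂ (f k)) atTop (ball z r) := by
    rw [Metric.uniformCauchySeqOn_iff] at h ⊢
    intro ε hε
    obtain ⟨N, hN⟩ := h (ε * r / 4) (by positivity)
    refine ⟨N, fun m hm n hn x hx => ?_⟩
    -- Cauchy estimate: `f m - f n` is smaller than `ε r / 4` on the large ball, so it varies by at
    -- most `ε r / 2` on `ball x r`. The resulting bound `ε / 2` is below `ε`.
    have hle : ‖fderiv ℂ (fun y => f m y - f n y) x‖ ≤ (ε * r / 2) / r := by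
      refine Complex.norm_fderiv_le_div_of_mapsTo_ball
        (((hf m).sub (hf n)).mono (hsub x hx)) (fun y hy => ?_) hr
      have h1 := hN m hm n hn y (hsub x hx hy)
      have h2 := hN m hm n hn x (hself hx)
      rw [dist_eq_norm] at h1 h2
      rw [mem_closedBall, dist_eq_norm]
      linarith [norm_sub_le (f m y - f n y) (f m x - f n x)]
    rw [fderiv_fun_sub (hdiff m x hx) (hdiff n x hx)] at hle
    rw [dist_eq_norm]
    refine hle.trans_lt ?_
    rw [div_lt_iff₀ hr]
    nlinarith
  have hlim : ∀ x ∈ ball z r, ∃ L, Tendsto (fun k => fderiv ℂ (f k) x) atTop (𝓝 L) := fun x hx =>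
    cauchySeq_tendsto_of_complete (hC.cauchySeq hx)
  choose! g' hg' using hlim
  exact (hasFDerivAt_of_tendstoUniformlyOn isOpen_ball (hC.tendstoUniformlyOn_of_tendsto hg')
    (fun k x hx => (hdiff k x hx).hasFDerivAt) (fun x hx => hg x (hself hx))
    (mem_ball_self hr)).differentiableAt

lemma integral_norm_sq_eq {α : Type*} [MeasurableSpace α] {μ : Measure α} (g : Lp ℂ 2 μ)
    {f : α → ℂ}
    (h : g =ᵐ[μ] f) : ∫ u, ‖f u‖ ^ 2 ∂μ = ‖g‖ ^ 2 := by
  have h1 : RCLike.re (inner ℂ g g) = ‖g‖ ^ 2 := inner_self_eq_norm_sq g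
  rw [L2.inner_def, ← integral_re (L2.integrable_inner g g)] at h1
  rw [← h1]
  refine integral_congr_ae ?_
  filter_upwards [h] with u hu
  rw [← hu, inner_self_eq_norm_sq]

lemma integrable_conj_mul {α : Type*} [MeasurableSpace α] {μ : Measure α} {θ φ : α → ℂ}
    (hθ : MemLp θ 2 μ) (hφ : MemLp φ 2 μ) : Integrable (fun z => conj (θ z) * φ z) μ :=
  hθ.star.integrable_mul hφ

/-! ### Weighted Bergman spaces on open sets and their orthogonal projections -/

section WeightedBergman

variable {ι : Type*} [Fintype ι] {U : Set (ι → ℂ)} {w : (ι → ℂ) → ℝ}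

/-- Lebesgue measure on `U` with the density `w`. -/
noncomputable def weightedMeasure (U : Set (ι → ℂ)) (w : (ι → ℂ) → ℝ) : Measure (ι → ℂ) :=
  (volume.restrict U).withDensity fun z => ENNReal.ofReal (w z)

lemma integrable_weightedMeasure (hU : IsOpen U) (hw : Measurable w) (hpos : ∀ z ∈ U, 0 < w z)
    (f : (ι → ℂ) → ℂ) :
    Integrable f (weightedMeasure U w) ↔ IntegrableOn (fun z => (w z : ℂ) * f z) U := by
  rw [weightedMeasure, integrable_withDensity_iff_integrable_smul' hw.ennreal_ofReal (by simp)]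
  refine integrable_congr ?_
  filter_upwards [ae_restrict_mem hU.measurableSet] with z hz
  rw [ENNReal.toReal_ofReal (hpos z hz).le, Complex.real_smul]

lemma integral_weightedMeasure {F : Type*} [NormedAddCommGroup F] [NormedSpace ℝ F]
    (hU : IsOpen U) (hw : Measurable w) (hpos : ∀ z ∈ U, 0 < w z) (f : (ι → ℂ) → F) :
    ∫ z, f z ∂(weightedMeasure U w) = ∫ z in U, w z • f z := by
  rw [weightedMeasure, integral_withDensity_eq_integral_toReal_smul hw.ennreal_ofReal (by simp)]
  refine setIntegral_congr_fun hU.measurableSet fun z hz => ?_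
  simp only [ENNReal.toReal_ofReal (hpos z hz).le]

lemma ae_weightedMeasure_mem (hU : IsOpen U) : ∀ᵐ z ∂(weightedMeasure U w), z ∈ U :=
  (withDensity_absolutelyContinuous _ _).ae_le (ae_restrict_mem hU.measurableSet)

lemma aestronglyMeasurable_weightedMeasure (hU : IsOpen U) {f : (ι → ℂ) → ℂ}
    (hf : ContinuousOn f U) : AEStronglyMeasurable f (weightedMeasure U w) :=
  (hf.aestronglyMeasurable hU.measurableSet).mono_ac (withDensity_absolutelyContinuous _ _)

/-- Point evaluations are locally uniformly bounded: the weight has a positive minimum on a compact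
ball, which reduces the claim to the unweighted `norm_sq_mul_le_setIntegral`. -/
lemma exists_norm_sq_le_integral (hU : IsOpen U) (hw : Measurable w)
    (hwc : ContinuousOn w U) (hpos : ∀ z ∈ U, 0 < w z) {z₀ : ι → ℂ} (hz₀ : z₀ ∈ U) :
    ∃ r > 0, ball z₀ (2 * r) ⊆ U ∧ ∃ C : ℝ, 0 ≤ C ∧ ∀ f : (ι → ℂ) → ℂ, DifferentiableOn ℂ f U →
      MemLp f 2 (weightedMeasure U w) → ∀ z ∈ ball z₀ (2 * r),
        ‖f z‖ ^ 2 ≤ C * ∫ u, ‖f u‖ ^ 2 ∂(weightedMeasure U w) := by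
  obtain ⟨R, hR, hRU⟩ := nhds_basis_closedBall.mem_iff.1 (hU.mem_nhds hz₀)
  obtain ⟨x, hx, hmin⟩ := (isCompact_closedBall z₀ R).exists_isMinOn ⟨z₀, mem_closedBall_self hR.le⟩
    (hwc.mono hRU)
  have hm : 0 < w x := hpos x (hRU hx)
  have hv : 0 < volume.real (closedBall (0 : ι → ℂ) (R / 2)) :=
    ENNReal.toReal_pos (measure_closedBall_pos _ _ (by positivity)).ne'
      measure_closedBall_lt_top.ne
  -- With this choice `ball z₀ (2 * r)` has radius `R / 2`, so the ball of radius `R / 2` about each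
  -- of its points stays in `closedBall z₀ R`.
  refine ⟨R / 4, by positivity,
    (ball_subset_closedBall.trans (closedBall_subset_closedBall (by linarith))).trans hRU,
    (w x * volume.real (closedBall (0 : ι → ℂ) (R / 2)))⁻¹, by positivity, fun f hf hfL z hz => ?_⟩
  have hsub : closedBall z (R / 2) ⊆ closedBall z₀ R :=
    closedBall_subset_closedBall' (by rw [mem_ball] at hz; linarith)
  have h1 := norm_sq_mul_le_setIntegral f z hf (hsub.trans hRU)
  have hsq : Integrable (fun u => ‖f u‖ ^ 2) (weightedMeasure U w) := (memLp_two_iff_integrable_sq_norm hfL.1).1 hfL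
  have hint : IntegrableOn (fun u => w u • ‖f u‖ ^ 2) U := by
    rw [weightedMeasure,
      integrable_withDensity_iff_integrable_smul' hw.ennreal_ofReal (by simp)] at hsq
    refine (integrable_congr ?_).1 hsq
    filter_upwards [ae_restrict_mem hU.measurableSet] with z hz
    rw [ENNReal.toReal_ofReal (hpos z hz).le]
  have h2 : w x * ∫ u in closedBall z (R / 2), ‖f u‖ ^ 2 ≤
      ∫ u, ‖f u‖ ^ 2 ∂(weightedMeasure U w) := by
    rw [integral_weightedMeasure hU hw hpos, ← integral_const_mul]
    have hcont : ContinuousOn (fun u => w x * ‖f u‖ ^ 2) (closedBall z (R / 2)) :=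
      continuousOn_const.mul ((hf.continuousOn.mono (hsub.trans hRU)).norm.pow 2)
    calc _ ≤ ∫ u in closedBall z (R / 2), w u • ‖f u‖ ^ 2 := by
          refine setIntegral_mono_on (hcont.integrableOn_compact (isCompact_closedBall _ _))
            (hint.mono_set (hsub.trans hRU)) measurableSet_closedBall fun u hu => ?_
          exact mul_le_mul_of_nonneg_right (hmin (hsub hu)) (by positivity)
      _ ≤ _ := by
          refine setIntegral_mono_set hint ?_ (hsub.trans hRU).eventuallyLE
          filter_upwards [ae_restrict_mem hU.measurableSet] with u hu
          have := hpos u hu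
          simp only [Pi.zero_apply, smul_eq_mul]
          positivity
  rw [← div_eq_inv_mul, le_div_iff₀ (by positivity)]
  nlinarith

/-- The classes in `L²` of the holomorphic functions on `U`. -/
def holomorphicSubmodule (U : Set (ι → ℂ)) (μ : Measure (ι → ℂ)) : Submodule ℂ (Lp ℂ 2 μ) where
  carrier := {g | ∃ h, DifferentiableOn ℂ h U ∧ g =ᵐ[μ] h}
  add_mem' := by
    rintro a b ⟨h, hh, ha⟩ ⟨k, hk, hb⟩
    exact ⟨h + k, hh.add hk, (Lp.coeFn_add a b).trans (ha.add hb)⟩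
  zero_mem' := ⟨0, differentiableOn_const 0, Lp.coeFn_zero _ _ _⟩
  smul_mem' := by
    rintro c a ⟨h, hh, ha⟩
    exact ⟨c • h, hh.const_smul c, (Lp.coeFn_smul c a).trans (ha.const_smul c)⟩

/-- By the bound on point evaluations, `L²` convergence forces locally uniform convergence of the
holomorphic representatives, so their pointwise limit is holomorphic. -/
lemma isClosed_holomorphicSubmodule (hU : IsOpen U) (hw : Measurable w)
    (hwc : ContinuousOn w U) (hpos : ∀ z ∈ U, 0 < w z) :
    IsClosed (holomorphicSubmodule U (weightedMeasure U w) : Set (Lp ℂ 2 (weightedMeasure U w))) := by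
  set μ := weightedMeasure U w with hμ
  refine IsSeqClosed.isClosed fun g g₀ hg hlim => ?_
  choose h hh hgh using hg
  have hbound : ∀ z₀ ∈ U, ∃ r > 0, ball z₀ (2 * r) ⊆ U ∧
      UniformCauchySeqOn h atTop (ball z₀ (2 * r)) := by
    intro z₀ hz₀
    obtain ⟨r, hr, hrU, C, hC, hf⟩ := exists_norm_sq_le_integral hU hw hwc hpos hz₀
    refine ⟨r, hr, hrU, ?_⟩
    rw [Metric.uniformCauchySeqOn_iff]
    intro ε hε
    have hcauchy := hlim.cauchySeq
    rw [Metric.cauchySeq_iff] at hcauchy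
    obtain ⟨N, hN⟩ := hcauchy (ε / (Real.sqrt C + 1)) (by positivity)
    refine ⟨N, fun m hm n hn z hz => ?_⟩
    have hae : ((g m - g n : Lp ℂ 2 μ) : (ι → ℂ) → ℂ) =ᵐ[μ] h m - h n :=
      (Lp.coeFn_sub _ _).trans ((hgh m).sub (hgh n))
    have h1 := hf (h m - h n) ((hh m).sub (hh n)) ((Lp.memLp (g m - g n)).ae_eq hae) z hz
    rw [integral_norm_sq_eq _ hae, ← Real.sq_sqrt hC, ← mul_pow] at h1
    have h2 := abs_le_of_sq_le_sq' h1 (by positivity)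
    have h3 := hN m hm n hn
    rw [dist_eq_norm, lt_div_iff₀ (by positivity)] at h3
    rw [dist_eq_norm]
    have h4 : ‖h m z - h n z‖ ≤ Real.sqrt C * ‖g m - g n‖ := h2.2
    nlinarith [norm_nonneg (g m - g n)]
  have hlimh : ∀ z ∈ U, ∃ L, Tendsto (fun k => h k z) atTop (𝓝 L) := by
    intro z hz
    obtain ⟨r, hr, -, hc⟩ := hbound z hz
    exact cauchySeq_tendsto_of_complete (hc.cauchySeq (mem_ball_self (by positivity)))
  choose! h₀ hh₀ using hlimh
  refine ⟨h₀, fun z hz => ?_, ?_⟩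
  · obtain ⟨r, hr, hrU, hc⟩ := hbound z hz
    exact (differentiableAt_of_uniformCauchySeqOn hr (fun k => (hh k).mono hrU) hc
      fun x hx => hh₀ x (hrU hx)).differentiableWithinAt
  -- The `L²` limit is an almost everywhere limit along a subsequence, which identifies it with the
  -- pointwise limit.
  · obtain ⟨ns, hns, hae⟩ := (tendstoInMeasure_of_tendsto_Lp hlim).exists_seq_tendsto_ae
    filter_upwards [hae, ae_weightedMeasure_mem hU, ae_all_iff.2 hgh] with z hz hzU hzg
    refine tendsto_nhds_unique hz ?_
    simp only [hzg]
    exact (hh₀ z hzU).comp hns.tendsto_atTop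

/-- The orthogonal projection onto the weighted Bergman space. -/
lemma exists_holomorphic_projection (hU : IsOpen U) (hw : Measurable w)
    (hwc : ContinuousOn w U) (hpos : ∀ z ∈ U, 0 < w z) {φ : (ι → ℂ) → ℂ}
    (hφ : MemLp φ 2 (weightedMeasure U w)) :
    ∃ h, DifferentiableOn ℂ h U ∧ MemLp h 2 (weightedMeasure U w) ∧
      ∀ θ, DifferentiableOn ℂ θ U → MemLp θ 2 (weightedMeasure U w) →
        ∫ z, conj (θ z) * φ z ∂(weightedMeasure U w) =
          ∫ z, conj (θ z) * h z ∂(weightedMeasure U w) := by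
  set μ := weightedMeasure U w with hμ
  let K := holomorphicSubmodule U μ
  have hK : CompleteSpace K :=
    (isClosed_holomorphicSubmodule hU hw hwc hpos).completeSpace_coe
  obtain ⟨h, hh, hgh⟩ := K.starProjection_apply_mem hφ.toLp
  refine ⟨h, hh, (Lp.memLp _).ae_eq hgh, fun θ hθ hθL => ?_⟩
  have hmem : hθL.toLp ∈ K := ⟨θ, hθ, hθL.coeFn_toLp⟩
  have h0 := K.sub_starProjection_mem_orthogonal hφ.toLp _ hmem
  rw [inner_sub_right, sub_eq_zero, L2.inner_def, L2.inner_def] at h0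
  convert h0 using 1
  · refine integral_congr_ae ?_
    filter_upwards [hθL.coeFn_toLp, hφ.coeFn_toLp] with z h1 h2
    rw [h1, h2, RCLike.inner_apply, mul_comm]
  · refine integral_congr_ae ?_
    filter_upwards [hθL.coeFn_toLp, hgh] with z h1 h2
    rw [h1, h2, RCLike.inner_apply, mul_comm]

lemma eqOn_zero_of_integral_conj_mul_self (hU : IsOpen U) (hw : Measurable w)
    (hwc : ContinuousOn w U) (hpos : ∀ z ∈ U, 0 < w z) {f : (ι → ℂ) → ℂ}
    (hf : DifferentiableOn ℂ f U) (hfL : MemLp f 2 (weightedMeasure U w))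
    (h0 : ∫ z, conj (f z) * f z ∂(weightedMeasure U w) = 0) : ∀ z ∈ U, f z = 0 := by
  intro z hz
  obtain ⟨r, hr, -, C, hC, hb⟩ := exists_norm_sq_le_integral hU hw hwc hpos hz
  have h1 := hb f hf hfL z (mem_ball_self (by positivity))
  have h2 : ((∫ u, ‖f u‖ ^ 2 ∂(weightedMeasure U w) : ℝ) : ℂ) = 0 := by
    rw [← h0, ← integral_complex_ofReal]
    refine integral_congr_ae (Eventually.of_forall fun u => ?_)
    simp only [Complex.conj_mul', Complex.ofReal_pow]
  rw [Complex.ofReal_eq_zero.1 h2, mul_zero] at h1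
  simpa using le_antisymm h1 (by positivity)

end WeightedBergman

end SuperToeplitz

namespace SuperToeplitz

/-! ### Bergman projections on the ball and the Siegel domain -/

section Bergman

variable (V : BaseDomain) (n : ℕ)

lemma continuous_rho : Continuous fun z : Fin (n + 1) → ℂ => V.rho z := by
  cases V <;> simp only [BaseDomain.rho] <;> fun_prop

lemma isOpen_carrier : IsOpen (V.carrier n) :=
  isOpen_lt continuous_const (continuous_rho V n)

lemma kappa_pos : 0 < V.kappa := by cases V <;> norm_num [BaseDomain.kappa]

/-- The density of the measure `bergmanMeasure`. -/
noncomputable def bergmanWeight (a : ℝ) (z : Fin (n + 1) → ℂ) : ℝ :=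
  V.kappa * Real.Gamma a / (Real.pi ^ (n + 1) * Real.Gamma (a - (n + 1))) *
    V.rho z ^ (a - (n + 1) - 1)

lemma bergmanMeasure_eq (a : ℝ) :
    bergmanMeasure V n a = weightedMeasure (V.carrier n) (bergmanWeight V n a) := rfl

lemma measurable_bergmanWeight (a : ℝ) : Measurable (bergmanWeight V n a) :=
  ((continuous_rho V n).measurable.pow_const _).const_mul _

lemma continuousOn_bergmanWeight (a : ℝ) : ContinuousOn (bergmanWeight V n a) (V.carrier n) :=
  continuousOn_const.mul ((continuous_rho V n).continuousOn.rpow_const fun _ hz => Or.inl hz.ne')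

variable {n}

lemma bergmanWeight_pos {a : ℝ} (ha : (n : ℝ) + 1 < a) {z : Fin (n + 1) → ℂ}
    (hz : z ∈ V.carrier n) : 0 < bergmanWeight V n a z := by
  have hn : (0 : ℝ) ≤ n := n.cast_nonneg
  have h1 := Real.Gamma_pos_of_pos (show 0 < a by linarith)
  have h2 := Real.Gamma_pos_of_pos (show 0 < a - (n + 1) by linarith)
  have h3 : 0 < V.rho z ^ (a - (n + 1) - 1) := Real.rpow_pos_of_pos hz _
  have h4 := kappa_pos V
  rw [bergmanWeight]
  positivity

variable {V} {a : ℝ} (ha : (n : ℝ) + 1 < a)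

include ha

lemma integrable_bergmanMeasure (f : (Fin (n + 1) → ℂ) → ℂ) :
    Integrable f (bergmanMeasure V n a) ↔
      IntegrableOn (fun z => (bergmanWeight V n a z : ℂ) * f z) (V.carrier n) :=
  integrable_weightedMeasure (isOpen_carrier V n) (measurable_bergmanWeight V n a)
    (fun _ => bergmanWeight_pos V ha) f

lemma integral_bergmanMeasure (f : (Fin (n + 1) → ℂ) → ℂ) :
    ∫ z, f z ∂(bergmanMeasure V n a) = ∫ z in V.carrier n, (bergmanWeight V n a z : ℂ) * f z := by
  rw [bergmanMeasure_eq, integral_weightedMeasure (isOpen_carrier V n)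
    (measurable_bergmanWeight V n a) (fun _ => bergmanWeight_pos V ha)]
  simp only [Complex.real_smul]

lemma exists_isBergmanProj {φ : (Fin (n + 1) → ℂ) → ℂ} (hφ : MemLp φ 2 (bergmanMeasure V n a)) :
    ∃ h, IsBergmanProj V a φ h := by
  obtain ⟨h, hh, hhL, hproj⟩ := exists_holomorphic_projection (isOpen_carrier V n)
    (measurable_bergmanWeight V n a) (continuousOn_bergmanWeight V n a)
    (fun _ => bergmanWeight_pos V ha) hφ
  exact ⟨h, ⟨hh, hhL⟩, fun θ hθ => ⟨integrable_conj_mul hθ.2 hφ, hproj θ hθ.1 hθ.2⟩⟩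

/-- On the domain of the Toeplitz operator the default value `0` in `bergmanProj` is never used. -/
lemma isBergmanProj_toeplitz {f ψ : (Fin (n + 1) → ℂ) → ℂ}
    (h : MemLp (fun z => f z * ψ z) 2 (bergmanMeasure V n a)) :
    IsBergmanProj V a (fun z => f z * ψ z) (toeplitz V a f ψ) := by
  have hex := exists_isBergmanProj ha h
  rw [toeplitz, bergmanProj, dif_pos hex]
  exact hex.choose_spec

/-- The difference `g - h` lies in the Bergman space and is orthogonal to it, hence to itself. The
function `φ` need not be square integrable. -/
lemma IsBergmanProj.eqOn {φ g h : (Fin (n + 1) → ℂ) → ℂ} (hg : IsBergmanProj V a φ g)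
    (hh : IsBergmanProj V a φ h) : ∀ z ∈ V.carrier n, g z = h z := by
  have hd : MemBergman V a (g - h) := ⟨hg.1.1.sub hh.1.1, hg.1.2.sub hh.1.2⟩
  have h1 := (hg.2 _ hd).2.symm.trans (hh.2 _ hd).2
  have h2 : ∫ z, conj ((g - h) z) * (g - h) z ∂(bergmanMeasure V n a) = 0 := by
    rw [bergmanInner, bergmanInner, ← sub_eq_zero,
      ← integral_sub (integrable_conj_mul hd.2 hg.1.2) (integrable_conj_mul hd.2 hh.1.2)] at h1
    rw [← h1]
    simp only [Pi.sub_apply, mul_sub]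
  intro z hz
  exact sub_eq_zero.1 (eqOn_zero_of_integral_conj_mul_self (isOpen_carrier V n)
    (measurable_bergmanWeight V n a) (continuousOn_bergmanWeight V n a)
    (fun _ => bergmanWeight_pos V ha) hd.1 hd.2 h2 z hz)

omit ha

lemma IsBergmanProj.sum {κ : Type*} (s : Finset κ) (c : κ → ℂ) {φ h : κ → (Fin (n + 1) → ℂ) → ℂ}
    (H : ∀ k ∈ s, IsBergmanProj V a (φ k) (h k)) :
    IsBergmanProj V a (fun z => ∑ k ∈ s, c k * φ k z) (fun z => ∑ k ∈ s, c k * h k z) := by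
  refine ⟨⟨DifferentiableOn.fun_sum fun k hk => (H k hk).1.1.const_mul _,
    memLp_finsetSum _ fun k hk => (H k hk).1.2.const_mul _⟩, fun θ hθ => ?_⟩
  have e : ∀ f : κ → (Fin (n + 1) → ℂ) → ℂ, (fun z => conj (θ z) * ∑ k ∈ s, c k * f k z) =
      fun z => ∑ k ∈ s, c k * (conj (θ z) * f k z) := by
    intro f
    funext z
    rw [Finset.mul_sum]
    exact Finset.sum_congr rfl fun k _ => mul_left_comm _ _ _
  refine ⟨?_, ?_⟩
  · rw [e]
    exact integrable_finsetSum _ fun k hk => ((H k hk).2 θ hθ).1.const_mul _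
  · rw [bergmanInner, bergmanInner, e, e,
      integral_finsetSum _ fun k hk => ((H k hk).2 θ hθ).1.const_mul _,
      integral_finsetSum _ fun k hk => (integrable_conj_mul hθ.2 (H k hk).1.2).const_mul _]
    refine Finset.sum_congr rfl fun k hk => ?_
    rw [integral_const_mul, integral_const_mul]
    exact congrArg _ ((H k hk).2 θ hθ).2

lemma memBergman_zero : MemBergman V a (0 : (Fin (n + 1) → ℂ) → ℂ) :=
  ⟨differentiableOn_const 0, MemLp.zero'⟩

end Bergman

/-! ### The density of the super pairing after odd integration -/

section SuperDensity

variable {V : BaseDomain} {n q : ℕ} {ν : ℝ}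

/-- The weight of `conj θ_K * φ_K` in `superDensity`. -/
noncomputable def componentWeight (V : BaseDomain) {n q : ℕ} (ν : ℝ) (K : Finset (Fin q))
    (z : Fin (n + 1) → ℂ) : ℝ :=
  Real.Gamma (ν + q - (n + 1)) / Real.Gamma (ν + K.card - (n + 1)) *
    V.rho z ^ (ν + K.card - (n + 1) - 1)

/-- As `|Aᶜ| = q - |A|`, the summand `q` in the exponent of the super weight cancels, leaving the
exponent of the space of weight `ν + |A|`. -/
lemma berezin_superWeight (hν : (n : ℝ) + 1 < ν) (z : Fin (n + 1) → ℂ) (A B : Finset (Fin q)) :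
    berezin q (superWeight V q ν z * (xiStar A * xi B)) =
      if A = B then (componentWeight V ν A z : ℂ) else 0 := by
  have hc : (Aᶜ.card : ℝ) = q - A.card := by
    have := Finset.card_add_card_compl A
    rw [Fintype.card_fin] at this
    rw [eq_sub_iff_add_eq']
    exact_mod_cast this
  have hA : (0 : ℝ) ≤ A.card := Nat.cast_nonneg _
  rw [superWeight, berezin_superRpow _ _ _ _ (by rw [hc]; linarith), componentWeight, hc,
    show ν + q - (n + 1) - 1 + 1 = ν + q - (n + 1) by ring,
    show ν + q - (n + 1) - (q - A.card) = ν + A.card - (n + 1) by ring,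
    show ν + q - (n + 1) - 1 - (q - A.card) = ν + A.card - (n + 1) - 1 by ring]

lemma superDensity_superHol (hν : (n : ℝ) + 1 < ν)
    (θ ψ : Finset (Fin q) → (Fin (n + 1) → ℂ) → ℂ) (z : Fin (n + 1) → ℂ) :
    superDensity V ν θ (superHol ψ) z =
      ∑ M, (componentWeight V ν M z : ℂ) * (conj (θ M z) * ψ M z) := by
  rw [superDensity, superHolStar, superHol, mul_assoc, Finset.sum_mul_sum, Finset.mul_sum, map_sum]
  refine Finset.sum_congr rfl fun M _ => ?_
  rw [Finset.mul_sum, map_sum]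
  simp only [mul_smul_comm, smul_mul_assoc, map_smul, berezin_superWeight hν, smul_eq_mul,
    mul_ite, mul_zero, Finset.sum_ite_eq, Finset.mem_univ, if_true]
  ring

lemma berezin_superWeight_mul (hν : (n : ℝ) + 1 < ν) (z : Fin (n + 1) → ℂ)
    (I A B J : Finset (Fin q)) :
    berezin q (superWeight V q ν z * xiStar I * (xiStar A * xi B * xi J)) =
      if Disjoint A I ∧ Disjoint B J ∧ A ∪ I = B ∪ J then
        eps A I * eps B J * (componentWeight V ν (A ∪ I) z : ℂ) else 0 := by
  have e : superWeight V q ν z * xiStar I * (xiStar A * xi B * xi J) =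
      superWeight V q ν z * ((xiStar I * xiStar A) * (xi B * xi J)) := by
    simp only [mul_assoc]
  rw [e, xiStar_mul_xiStar, xi_mul_xi']
  by_cases h1 : Disjoint A I
  · by_cases h2 : Disjoint B J
    · rw [if_pos h1, if_pos h2, smul_mul_smul_comm, mul_smul_comm, map_smul,
        berezin_superWeight hν]
      by_cases h3 : A ∪ I = B ∪ J
      · rw [if_pos h3, if_pos ⟨h1, h2, h3⟩, smul_eq_mul]
      · rw [if_neg h3, if_neg fun h => h3 h.2.2, smul_zero]
    · rw [if_pos h1, if_neg h2, if_neg (not_and_of_not_right _ (not_and_of_not_left _ h2))]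
      simp
  · rw [if_neg h1, if_neg (not_and_of_not_left _ h1)]
    simp

/-- Reindexing by `K = A ∪ I = B ∪ J`, which determines `A` and `B`. -/
lemma sum_disjoint_union_eq (I J : Finset (Fin q))
    (h : Finset (Fin q) → Finset (Fin q) → Finset (Fin q) → ℂ) :
    ∑ A, ∑ B, (if Disjoint A I ∧ Disjoint B J ∧ A ∪ I = B ∪ J then h A B (A ∪ I) else 0) =
      ∑ K : Finset (Fin q) with I ∪ J ⊆ K, h (K \ I) (K \ J) K := by
  rw [← Fintype.sum_prod_type' (f := fun A B =>
    if Disjoint A I ∧ Disjoint B J ∧ A ∪ I = B ∪ J then h A B (A ∪ I) else 0),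
    ← Finset.sum_filter]
  refine Finset.sum_bij' (fun x _ => x.1 ∪ I) (fun K _ => (K \ I, K \ J)) ?_ ?_ ?_ ?_ ?_
  · rintro ⟨A, B⟩ hx
    obtain ⟨-, -, h3⟩ := (Finset.mem_filter.1 hx).2
    rw [Finset.mem_filter]
    refine ⟨Finset.mem_univ _, Finset.union_subset Finset.subset_union_right ?_⟩
    change J ⊆ A ∪ I
    rw [show A ∪ I = B ∪ J from h3]
    exact Finset.subset_union_right
  · intro K hK
    have hK := (Finset.mem_filter.1 hK).2
    have hI := Finset.subset_union_left.trans hK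
    have hJ := Finset.subset_union_right.trans hK
    rw [Finset.mem_filter]
    refine ⟨Finset.mem_univ _, Finset.sdiff_disjoint, Finset.sdiff_disjoint, ?_⟩
    rw [Finset.sdiff_union_of_subset hI, Finset.sdiff_union_of_subset hJ]
  · rintro ⟨A, B⟩ hx
    obtain ⟨h1, h2, h3⟩ := (Finset.mem_filter.1 hx).2
    change ((A ∪ I) \ I, (A ∪ I) \ J) = (A, B)
    rw [Finset.union_sdiff_cancel_right h1, show A ∪ I = B ∪ J from h3,
      Finset.union_sdiff_cancel_right h2]
  · intro K hK
    exact Finset.sdiff_union_of_subset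
      (Finset.subset_union_left.trans (Finset.mem_filter.1 hK).2)
  · rintro ⟨A, B⟩ hx
    obtain ⟨h1, h2, h3⟩ := (Finset.mem_filter.1 hx).2
    change h A B (A ∪ I) = h ((A ∪ I) \ I) ((A ∪ I) \ J) (A ∪ I)
    rw [Finset.union_sdiff_cancel_right h1]
    congr 1
    rw [show A ∪ I = B ∪ J from h3, Finset.union_sdiff_cancel_right h2]

lemma superDensity_mul_superHol (hν : (n : ℝ) + 1 < ν)
    (F : Finset (Fin q) → Finset (Fin q) → (Fin (n + 1) → ℂ) → ℂ)
    (θ ψ : Finset (Fin q) → (Fin (n + 1) → ℂ) → ℂ) (z : Fin (n + 1) → ℂ) :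
    superDensity V ν θ
        (fun z => (∑ A, ∑ B, F A B z • (xiStar A * xi B)) * superHol ψ z) z =
      ∑ I, ∑ J, ∑ K : Finset (Fin q) with I ∪ J ⊆ K,
        conj (θ I z) * (F (K \ I) (K \ J) z * ψ J z) *
          (eps (K \ I) I * eps (K \ J) J * (componentWeight V ν K z : ℂ)) := by
  simp only [superDensity, superHolStar, superHol, Finset.mul_sum, Finset.sum_mul, map_sum,
    mul_smul_comm, smul_mul_assoc, map_smul,
    berezin_superWeight_mul hν, smul_eq_mul]
  conv_rhs =>
    enter [2, I, 2, J]
    rw [← sum_disjoint_union_eq I J fun A B K => conj (θ I z) * (F A B z * ψ J z) *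
      (eps A I * eps B J * (componentWeight V ν K z : ℂ))]
  symm
  rw [Finset.sum_comm]
  refine Finset.sum_congr rfl fun J _ => ?_
  rw [Finset.sum_comm]
  refine Finset.sum_congr rfl fun A _ => ?_
  rw [Finset.sum_comm]
  refine Finset.sum_congr rfl fun B _ => Finset.sum_congr rfl fun I _ => ?_
  split_ifs <;> ring

end SuperDensity

end SuperToeplitz

namespace SuperToeplitz

/-! ### Components of super functions and of the super projection -/

variable {V : BaseDomain} {n q : ℕ} {ν : ℝ}

/-- The factor in front of the integral in `superInner`. -/
noncomputable def superConst (V : BaseDomain) (n q : ℕ) (ν : ℝ) : ℝ :=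
  V.kappa * Real.Gamma ν / (Real.pi ^ (n + 1) * Real.Gamma (ν + q - (n + 1)))

/-- The factor of the component of index `I` in the decomposition of `superInner`. -/
noncomputable def componentConst (ν : ℝ) {q : ℕ} (I : Finset (Fin q)) : ℝ :=
  Real.Gamma ν / Real.Gamma (ν + I.card)

lemma lt_add_card (hν : (n : ℝ) + 1 < ν) (I : Finset (Fin q)) : (n : ℝ) + 1 < ν + I.card :=
  lt_add_of_lt_of_nonneg hν I.card.cast_nonneg

lemma componentConst_pos (hν : (n : ℝ) + 1 < ν) (I : Finset (Fin q)) :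
    0 < componentConst ν I := by
  have hn : (0 : ℝ) ≤ n := n.cast_nonneg
  have hI := lt_add_card hν I
  exact div_pos (Real.Gamma_pos_of_pos (by linarith)) (Real.Gamma_pos_of_pos (by linarith))

lemma superConst_pos (hν : (n : ℝ) + 1 < ν) : 0 < superConst V n q ν := by
  have hn : (0 : ℝ) ≤ n := n.cast_nonneg
  have hq : (0 : ℝ) ≤ q := q.cast_nonneg
  have h1 := Real.Gamma_pos_of_pos (show 0 < ν by linarith)
  have h2 := Real.Gamma_pos_of_pos (show 0 < ν + q - (n + 1) by linarith)
  have h3 := kappa_pos V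
  rw [superConst]
  positivity

/-- The `ξ_I`-component is tested in `H²_{ν+|I|}`, so the weight of a larger `K` has to be expressed
through that of `I`. The last factor is what enters the matrix; for `K = I` it is one. -/
lemma superConst_mul_componentWeight (hν : (n : ℝ) + 1 < ν) {z : Fin (n + 1) → ℂ}
    (hz : z ∈ V.carrier n) {I K : Finset (Fin q)} (hIK : I ⊆ K) :
    superConst V n q ν * componentWeight V ν K z =
      componentConst ν I * bergmanWeight V n (ν + I.card) z *
        (Real.Gamma (ν + I.card - (n + 1)) / Real.Gamma (ν + K.card - (n + 1)) *
          V.rho z ^ (K.card - I.card)) := by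
  have hn : (0 : ℝ) ≤ n := n.cast_nonneg
  have hq : (0 : ℝ) ≤ q := q.cast_nonneg
  have hI := lt_add_card hν I
  have hK := lt_add_card hν K
  have h1 := (Real.Gamma_pos_of_pos (show 0 < ν + q - (n + 1) by linarith)).ne'
  have h2 := (Real.Gamma_pos_of_pos (show 0 < ν + I.card - (n + 1) by linarith)).ne'
  have h3 := (Real.Gamma_pos_of_pos (show 0 < ν + K.card - (n + 1) by linarith)).ne'
  have h4 := (Real.Gamma_pos_of_pos (show 0 < ν + I.card by linarith)).ne'
  have h5 : V.rho z ^ (ν + K.card - (n + 1) - 1) =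
      V.rho z ^ (ν + I.card - (n + 1) - 1) * V.rho z ^ (K.card - I.card) := by
    rw [← Real.rpow_natCast, ← Real.rpow_add hz, Nat.cast_sub (Finset.card_le_card hIK)]
    congr 1
    ring
  rw [superConst, componentWeight, componentConst, bergmanWeight, h5]
  field_simp

/-- The components of a super function `Φ` with respect to the pairing `superDensity`. -/
def HasComponents (V : BaseDomain) (ν : ℝ) (Φ : (Fin (n + 1) → ℂ) → Grassmann q)
    (φ : Finset (Fin q) → (Fin (n + 1) → ℂ) → ℂ) : Prop :=
  ∀ θ : Finset (Fin q) → (Fin (n + 1) → ℂ) → ℂ, ∀ z ∈ V.carrier n,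
    (superConst V n q ν : ℂ) * superDensity V ν θ Φ z =
      ∑ I, (componentConst ν I : ℂ) *
        ((bergmanWeight V n (ν + I.card) z : ℂ) * (conj (θ I z) * φ I z))

lemma hasComponents_superHol (hν : (n : ℝ) + 1 < ν)
    (ψ : Finset (Fin q) → (Fin (n + 1) → ℂ) → ℂ) : HasComponents V ν (superHol ψ) ψ := by
  intro θ z hz
  rw [superDensity_superHol hν, Finset.mul_sum]
  refine Finset.sum_congr rfl fun I _ => ?_
  have h := superConst_mul_componentWeight hν hz (Finset.Subset.refl I)
  have h2 := (Real.Gamma_pos_of_pos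
    (show 0 < ν + I.card - (n + 1) by linarith [lt_add_card hν I])).ne'
  rw [div_self h2, Nat.sub_self, pow_zero, mul_one, mul_one] at h
  have h' := congrArg Complex.ofReal h
  rw [Complex.ofReal_mul, Complex.ofReal_mul] at h'
  linear_combination (conj (θ I z) * ψ I z) * h'

lemma hasComponents_xiStar_mul_xi (hν : (n : ℝ) + 1 < ν)
    (F : Finset (Fin q) → Finset (Fin q) → (Fin (n + 1) → ℂ) → ℂ)
    (ψ : Finset (Fin q) → (Fin (n + 1) → ℂ) → ℂ) :
    HasComponents V ν (fun z => (∑ A, ∑ B, F A B z • (xiStar A * xi B)) * superHol ψ z)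
      (fun I z => ∑ J, ∑ K : Finset (Fin q) with I ∪ J ⊆ K,
        (eps (K \ I) I * eps (K \ J) J *
          ((Real.Gamma (ν + I.card - (n + 1)) / Real.Gamma (ν + K.card - (n + 1)) : ℝ) : ℂ)) *
        (F (K \ I) (K \ J) z * ((V.rho z ^ (K.card - I.card) : ℝ) : ℂ) * ψ J z)) := by
  intro θ z hz
  rw [superDensity_mul_superHol hν]
  simp only [Finset.mul_sum]
  refine Finset.sum_congr rfl fun I _ => Finset.sum_congr rfl fun J _ =>
    Finset.sum_congr rfl fun K hK => ?_
  have h := congrArg (Complex.ofReal) (superConst_mul_componentWeight hν hz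
    (Finset.subset_union_left.trans (Finset.mem_filter.1 hK).2))
  rw [Complex.ofReal_mul, Complex.ofReal_mul, Complex.ofReal_mul, Complex.ofReal_mul] at h
  linear_combination (conj (θ I z) * (F (K \ I) (K \ J) z * ψ J z) *
    (eps (K \ I) I * eps (K \ J) J)) * h

section Components

variable {Φ : (Fin (n + 1) → ℂ) → Grassmann q} {φ : Finset (Fin q) → (Fin (n + 1) → ℂ) → ℂ}

lemma HasComponents.superDensity_eq (h : HasComponents V ν Φ φ) (hν : (n : ℝ) + 1 < ν)
    (θ : Finset (Fin q) → (Fin (n + 1) → ℂ) → ℂ) {z : Fin (n + 1) → ℂ} (hz : z ∈ V.carrier n) :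
    superDensity V ν θ Φ z = (superConst V n q ν : ℂ)⁻¹ * ∑ I, (componentConst ν I : ℂ) *
        ((bergmanWeight V n (ν + I.card) z : ℂ) * (conj (θ I z) * φ I z)) := by
  rw [← h θ z hz, inv_mul_cancel_left₀]
  exact_mod_cast (superConst_pos hν).ne'

lemma HasComponents.integrableOn (h : HasComponents V ν Φ φ) (hν : (n : ℝ) + 1 < ν)
    {θ : Finset (Fin q) → (Fin (n + 1) → ℂ) → ℂ}
    (hI : ∀ I, Integrable (fun z => conj (θ I z) * φ I z) (bergmanMeasure V n (ν + I.card))) :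
    IntegrableOn (superDensity V ν θ Φ) (V.carrier n) := by
  rw [integrableOn_congr_fun (fun z hz => h.superDensity_eq hν θ hz)
    (isOpen_carrier V n).measurableSet]
  refine Integrable.const_mul (integrable_finsetSum _ fun I _ => Integrable.const_mul ?_ _) _
  exact (integrable_bergmanMeasure (lt_add_card hν I) _).1 (hI I)

lemma HasComponents.superInner_eq (h : HasComponents V ν Φ φ) (hν : (n : ℝ) + 1 < ν)
    {θ : Finset (Fin q) → (Fin (n + 1) → ℂ) → ℂ}
    (hI : ∀ I, Integrable (fun z => conj (θ I z) * φ I z) (bergmanMeasure V n (ν + I.card))) :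
    superInner V ν θ Φ =
      ∑ I, (componentConst ν I : ℂ) * bergmanInner V (ν + I.card) (θ I) (φ I) := by
  change (superConst V n q ν : ℂ) * _ = _
  rw [← integral_const_mul, setIntegral_congr_fun (isOpen_carrier V n).measurableSet (h θ),
    integral_finsetSum _ fun I _ => Integrable.const_mul
      ((integrable_bergmanMeasure (lt_add_card hν I) _).1 (hI I)) _]
  refine Finset.sum_congr rfl fun I _ => ?_
  rw [integral_const_mul, bergmanInner, integral_bergmanMeasure (lt_add_card hν I)]

/-- A test function with a single nonzero component isolates one summand, so convergence of the
super integral cannot result from cancellation between components. -/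
lemma HasComponents.integrable_single (h : HasComponents V ν Φ φ) (hν : (n : ℝ) + 1 < ν)
    (I : Finset (Fin q)) (t : (Fin (n + 1) → ℂ) → ℂ)
    (hint : IntegrableOn (superDensity V ν (Pi.single I t) Φ) (V.carrier n)) :
    Integrable (fun z => conj (t z) * φ I z) (bergmanMeasure V n (ν + I.card)) := by
  rw [integrable_bergmanMeasure (lt_add_card hν I)]
  refine ((integrableOn_congr_fun (fun z hz => ?_) (isOpen_carrier V n).measurableSet).1
    (hint.const_mul ((superConst V n q ν : ℂ) * (componentConst ν I : ℂ)⁻¹)))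
  have hc : (componentConst ν I : ℂ) ≠ 0 := by exact_mod_cast (componentConst_pos hν I).ne'
  have e := h (Pi.single I t) z hz
  rw [Finset.sum_eq_single I (fun J _ hJ => by simp [Pi.single_eq_of_ne hJ]) (by simp),
    Pi.single_eq_same] at e
  rw [mul_right_comm, e]
  field_simp

end Components

/-- In the density of `(Ψ | Ψ)_ν` all components contribute nonnegative terms, so each is dominated
by the integrable sum. -/
theorem memSuperBergman_iff (hν : (n : ℝ) + 1 < ν)
    (ψ : Finset (Fin q) → (Fin (n + 1) → ℂ) → ℂ) :
    MemSuperBergman V ν ψ ↔ ∀ M, MemBergman V (ν + M.card) (ψ M) := by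
  have hcomp := hasComponents_superHol (V := V) hν ψ
  refine ⟨fun h M => ⟨h.1 M, ?_⟩, fun h => ⟨fun M => (h M).1, hcomp.integrableOn hν fun M =>
    integrable_conj_mul (h M).2 (h M).2⟩⟩
  have hM := lt_add_card hν M
  have hmeas : AEStronglyMeasurable (ψ M) (bergmanMeasure V n (ν + M.card)) :=
    aestronglyMeasurable_weightedMeasure (isOpen_carrier V n) (h.1 M).continuousOn
  have hc := componentConst_pos hν M
  have key : IntegrableOn (fun z => (bergmanWeight V n (ν + M.card) z : ℂ) *
      (conj (ψ M z) * ψ M z)) (V.carrier n) := by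
    refine Integrable.mono' (g := fun z => (componentConst ν M)⁻¹ *
      ‖(superConst V n q ν : ℂ) * superDensity V ν ψ (superHol ψ) z‖)
      ((h.2.const_mul _).norm.const_mul _) ?_ ?_
    · have hψ := (h.1 M).continuousOn
      refine ContinuousOn.aestronglyMeasurable ?_ (isOpen_carrier V n).measurableSet
      exact (Complex.continuous_ofReal.comp_continuousOn
        (continuousOn_bergmanWeight V n _)).mul
        ((Complex.continuous_conj.comp_continuousOn hψ).mul hψ)
    · filter_upwards [ae_restrict_mem (isOpen_carrier V n).measurableSet] with z hz
      have e : ∀ I, (componentConst ν I : ℂ) * ((bergmanWeight V n (ν + I.card) z : ℂ) *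
          (conj (ψ I z) * ψ I z)) = ((componentConst ν I *
            (bergmanWeight V n (ν + I.card) z * ‖ψ I z‖ ^ 2) : ℝ) : ℂ) := by
        intro I
        rw [Complex.conj_mul']
        push_cast
        rfl
      have hnn : ∀ I, 0 ≤ componentConst ν I *
          (bergmanWeight V n (ν + I.card) z * ‖ψ I z‖ ^ 2) := fun I => by
        have h1 := componentConst_pos hν I
        have h2 := bergmanWeight_pos V (lt_add_card hν I) hz
        positivity
      rw [hcomp ψ z hz, Finset.sum_congr rfl fun I _ => e I, ← Complex.ofReal_sum,
        Complex.norm_real, Real.norm_of_nonneg (Finset.sum_nonneg fun I _ => hnn I),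
        ← div_eq_inv_mul, le_div_iff₀' hc]
      calc _ = componentConst ν M * (bergmanWeight V n (ν + M.card) z * ‖ψ M z‖ ^ 2) := by
            rw [norm_mul, norm_mul, Complex.norm_real,
              Real.norm_of_nonneg (bergmanWeight_pos V hM hz).le, RCLike.norm_conj, sq]
        _ ≤ _ := Finset.single_le_sum (fun I _ => hnn I) (Finset.mem_univ M)
  rw [memLp_two_iff_integrable_sq_norm hmeas]
  refine ((integrable_bergmanMeasure hM _).2 key).norm.congr (Filter.Eventually.of_forall ?_)
  intro z
  simp [sq]

theorem superInner_superHol (hν : (n : ℝ) + 1 < ν)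
    {θ ψ : Finset (Fin q) → (Fin (n + 1) → ℂ) → ℂ} (hθ : MemSuperBergman V ν θ)
    (hψ : MemSuperBergman V ν ψ) :
    superInner V ν θ (superHol ψ) =
      ∑ M, (componentConst ν M : ℂ) * bergmanInner V (ν + M.card) (θ M) (ψ M) :=
  (hasComponents_superHol hν ψ).superInner_eq hν fun M =>
    integrable_conj_mul ((memSuperBergman_iff hν θ).1 hθ M).2
      ((memSuperBergman_iff hν ψ).1 hψ M).2

/-- The pairing is an orthogonal sum with positive factors `componentConst`: testing with `Pi.single
I t` gives the component conditions, and summing these gives the super condition. -/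
lemma HasComponents.isSuperProj_iff {Φ : (Fin (n + 1) → ℂ) → Grassmann q}
    {φ : Finset (Fin q) → (Fin (n + 1) → ℂ) → ℂ} (h : HasComponents V ν Φ φ)
    (hν : (n : ℝ) + 1 < ν) (χ : Finset (Fin q) → (Fin (n + 1) → ℂ) → ℂ) :
    IsSuperProj V ν Φ χ ↔ ∀ I, IsBergmanProj V (ν + I.card) (φ I) (χ I) := by
  constructor
  · rintro ⟨hχ, hproj⟩ I
    have hχ' := (memSuperBergman_iff hν χ).1 hχ
    refine ⟨hχ' I, fun t ht => ?_⟩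
    have hmem : ∀ J, MemBergman V (ν + J.card)
        ((Pi.single I t : Finset (Fin q) → (Fin (n + 1) → ℂ) → ℂ) J) := by
      intro J
      rcases eq_or_ne J I with rfl | hJ
      · rwa [Pi.single_eq_same]
      · rw [Pi.single_eq_of_ne hJ]
        exact memBergman_zero
    have hθ := (memSuperBergman_iff hν _).2 hmem
    obtain ⟨hint, heq⟩ := hproj _ hθ
    have hIint := h.integrable_single hν I t hint
    refine ⟨hIint, ?_⟩
    rw [h.superInner_eq hν, superInner_superHol hν hθ hχ,
      Finset.sum_eq_single I, Finset.sum_eq_single I, Pi.single_eq_same] at heq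
    · exact mul_left_cancel₀ (by exact_mod_cast (componentConst_pos hν I).ne') heq
    · intro J _ hJ
      simp [Pi.single_eq_of_ne hJ, bergmanInner]
    · simp
    · intro J _ hJ
      simp [Pi.single_eq_of_ne hJ, bergmanInner]
    · simp
    · intro J
      rcases eq_or_ne J I with rfl | hJ
      · rwa [Pi.single_eq_same]
      · simp [Pi.single_eq_of_ne hJ]
  · intro H
    have hχ := (memSuperBergman_iff hν χ).2 fun I => (H I).1
    refine ⟨hχ, fun θ hθ => ?_⟩
    have hθ' := (memSuperBergman_iff hν θ).1 hθ
    have hint := fun I => ((H I).2 (θ I) (hθ' I)).1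
    refine ⟨h.integrableOn hν hint, ?_⟩
    rw [h.superInner_eq hν hint, superInner_superHol hν hθ hχ]
    exact Finset.sum_congr rfl fun I _ => by rw [((H I).2 (θ I) (hθ' I)).2]

/-! ### Toeplitz matrices, general and diagonal -/

lemma hasToeplitzMatrix_of_hasComponents (hν : (n : ℝ) + 1 < ν)
    {F : (Fin (n + 1) → ℂ) → Grassmann q}
    {S : Finset (Fin q) → Finset (Fin q) → Finset (Finset (Fin q))}
    {c : Finset (Fin q) → Finset (Fin q) → Finset (Fin q) → ℂ}
    {s : Finset (Fin q) → Finset (Fin q) → Finset (Fin q) → (Fin (n + 1) → ℂ) → ℂ}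
    (h : ∀ ψ : Finset (Fin q) → (Fin (n + 1) → ℂ) → ℂ,
      HasComponents V ν (fun z => F z * superHol ψ z)
        (fun I z => ∑ J, ∑ K ∈ S I J, c I J K * (s I J K z * ψ J z))) :
    HasToeplitzMatrix V ν F S c s := by
  intro ψ _
  have hiff := (h ψ).isSuperProj_iff hν
  refine ⟨hiff, fun hL => ?_⟩
  have hT : ∀ I J, ∀ K ∈ S I J, IsBergmanProj V (ν + I.card) (fun z => s I J K z * ψ J z)
      (toeplitz V (ν + I.card) (s I J K) (ψ J)) := fun I J K hK =>
    isBergmanProj_toeplitz (lt_add_card hν I) (hL I J K hK)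
  have hsum : ∀ I, IsBergmanProj V (ν + I.card)
      (fun z => ∑ J, ∑ K ∈ S I J, c I J K * (s I J K z * ψ J z))
      (fun z => ∑ J, ∑ K ∈ S I J, c I J K * toeplitz V (ν + I.card) (s I J K) (ψ J) z) := by
    intro I
    -- Linearity is used twice: over `K` with the coefficients `c`, then over `J` with coefficients
    -- one.
    have := IsBergmanProj.sum Finset.univ (fun _ : Finset (Fin q) => (1 : ℂ))
      fun J _ => IsBergmanProj.sum (S I J) (c I J) (hT I J)
    simpa only [one_mul] using this
  exact ⟨hT, (hiff _).2 hsum, fun χ hχ I z hz =>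
    ((hiff χ).1 hχ I).eqOn (lt_add_card hν I) (hsum I) z hz⟩

theorem hasToeplitzMatrix_xiStar_mul_xi (hν : (n : ℝ) + 1 < ν)
    (F : Finset (Fin q) → Finset (Fin q) → (Fin (n + 1) → ℂ) → ℂ) :
    HasToeplitzMatrix V ν (fun z => ∑ A, ∑ B, F A B z • (xiStar A * xi B))
      (fun I J => {K | I ∪ J ⊆ K})
      (fun I J K => eps (K \ I) I * eps (K \ J) J *
        ((Real.Gamma (ν + I.card - (n + 1)) / Real.Gamma (ν + K.card - (n + 1)) : ℝ) : ℂ))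
      (fun I J K z => F (K \ I) (K \ J) z * ((V.rho z ^ (K.card - I.card) : ℝ) : ℂ)) :=
  hasToeplitzMatrix_of_hasComponents hν (hasComponents_xiStar_mul_xi hν F)

lemma sum_xi_mul_xiStar (F : Finset (Fin q) → Finset (Fin q) → ℂ) :
    ∑ A, ∑ B, F A B • (xi A * xiStar B) =
      ∑ A, ∑ B, ((-1) ^ (A.card * B.card) * F B A) • (xiStar A * xi B) := by
  rw [Finset.sum_comm]
  refine Finset.sum_congr rfl fun A _ => Finset.sum_congr rfl fun B _ => ?_
  rw [xi_mul_xiStar, smul_smul, mul_comm, mul_comm A.card]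

theorem hasToeplitzMatrix_xi_mul_xiStar (hν : (n : ℝ) + 1 < ν)
    (F : Finset (Fin q) → Finset (Fin q) → (Fin (n + 1) → ℂ) → ℂ) :
    HasToeplitzMatrix V ν (fun z => ∑ A, ∑ B, F A B z • (xi A * xiStar B))
      (fun I J => {K | I ∪ J ⊆ K})
      (fun I J K => (-1) ^ ((K \ I).card * (K \ J).card) * eps (K \ I) I * eps (K \ J) J *
        ((Real.Gamma (ν + I.card - (n + 1)) / Real.Gamma (ν + K.card - (n + 1)) : ℝ) : ℂ))
      (fun I J K z => F (K \ J) (K \ I) z * ((V.rho z ^ (K.card - I.card) : ℝ) : ℂ)) := by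
  refine hasToeplitzMatrix_of_hasComponents hν fun ψ => ?_
  have h := hasComponents_xiStar_mul_xi (V := V) hν
    (fun A B z => (-1) ^ (A.card * B.card) * F B A z) ψ
  simp only [← sum_xi_mul_xiStar (fun A B => F A B _)] at h
  convert h using 5 with I z J _ K
  ring

/-- For `I, J ⊆ K`, equality of the complements `K \ I` and `K \ J` forces `I = J`, so symbols
supported on `A = B` have no off-diagonal entries. -/
lemma sum_union_subset_eq_diagonal (I : Finset (Fin q))
    (f g : Finset (Fin q) → Finset (Fin q) → ℂ)
    (h0 : ∀ J K, I ⊆ K → J ⊆ K → K \ I ≠ K \ J → f J K = 0)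
    (h1 : ∀ K, I ⊆ K → f I K = g I K) :
    ∑ J, ∑ K : Finset (Fin q) with I ∪ J ⊆ K, f J K =
      ∑ J, ∑ K ∈ (if I = J then Finset.univ.filter (fun K => I ⊆ K) else ∅), g J K := by
  refine Finset.sum_congr rfl fun J _ => ?_
  split_ifs with hIJ
  · subst hIJ
    rw [Finset.union_self]
    exact Finset.sum_congr rfl fun K hK => h1 K (Finset.mem_filter.1 hK).2
  · rw [Finset.sum_empty]
    refine Finset.sum_eq_zero fun K hK => ?_
    have hK := (Finset.mem_filter.1 hK).2
    have hI := Finset.subset_union_left.trans hK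
    have hJ := Finset.subset_union_right.trans hK
    refine h0 J K hI hJ fun h => hIJ ?_
    rw [← Finset.sdiff_sdiff_eq_self hI, h, Finset.sdiff_sdiff_eq_self hJ]

theorem hasToeplitzMatrix_diagonal_xiStar_mul_xi (hν : (n : ℝ) + 1 < ν)
    (F : Finset (Fin q) → (Fin (n + 1) → ℂ) → ℂ) :
    HasToeplitzMatrix V ν (fun z => ∑ M, F M z • (xiStar M * xi M))
      (fun I J => if I = J then Finset.univ.filter (fun K => I ⊆ K) else ∅)
      (fun I _ K =>
        ((Real.Gamma (ν + I.card - (n + 1)) / Real.Gamma (ν + K.card - (n + 1)) : ℝ) : ℂ))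
      (fun I _ K z => F (K \ I) z * ((V.rho z ^ (K.card - I.card) : ℝ) : ℂ)) := by
  refine hasToeplitzMatrix_of_hasComponents hν fun ψ => ?_
  have h := hasComponents_xiStar_mul_xi (V := V) hν
    (fun A B z => if A = B then F A z else 0) ψ
  simp only [ite_smul, zero_smul, Finset.sum_ite_eq, Finset.mem_univ, if_true] at h
  convert h using 2 with I
  funext z
  refine (sum_union_subset_eq_diagonal I _ _ (fun J K _ _ hne => ?_) fun K _ => ?_).symm
  · rw [if_neg hne]
    ring
  · rw [if_pos rfl, eps_mul_self, one_mul]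

theorem hasToeplitzMatrix_diagonal_xi_mul_xiStar (hν : (n : ℝ) + 1 < ν)
    (F : Finset (Fin q) → (Fin (n + 1) → ℂ) → ℂ) :
    HasToeplitzMatrix V ν (fun z => ∑ M, F M z • (xi M * xiStar M))
      (fun I J => if I = J then Finset.univ.filter (fun K => I ⊆ K) else ∅)
      (fun I _ K => (-1) ^ (K \ I).card *
        ((Real.Gamma (ν + I.card - (n + 1)) / Real.Gamma (ν + K.card - (n + 1)) : ℝ) : ℂ))
      (fun I _ K z => F (K \ I) z * ((V.rho z ^ (K.card - I.card) : ℝ) : ℂ)) := by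
  -- The reordering sign for `A = B = M` is `(-1)^(|M|²)`, and `|M|²` has the parity of `|M|`.
  have hpow : ∀ k : ℕ, (-1 : ℂ) ^ (k * k) = (-1) ^ k := fun k => by
    rcases Nat.even_or_odd k with hk | hk
    · rw [hk.neg_one_pow, (hk.mul_right k).neg_one_pow]
    · rw [hk.neg_one_pow, (hk.mul hk).neg_one_pow]
  refine hasToeplitzMatrix_of_hasComponents hν fun ψ => ?_
  have h := hasComponents_xiStar_mul_xi (V := V) hν
    (fun A B z => if A = B then (-1) ^ A.card * F A z else 0) ψ
  simp only [ite_smul, zero_smul, Finset.sum_ite_eq, Finset.mem_univ, if_true] at h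
  convert h using 2 with z I
  · refine congrArg (· * superHol ψ z) (Finset.sum_congr rfl fun M _ => ?_)
    rw [xi_mul_xiStar, smul_smul, hpow, mul_comm]
  · funext z
    refine (sum_union_subset_eq_diagonal I _ _ (fun J K _ _ hne => ?_) fun K _ => ?_).symm
    · rw [if_neg hne]
      ring
    · rw [if_pos rfl, eps_mul_self, one_mul]
      ring

end SuperToeplitz

theorem mainTheorem11 (V : BaseDomain) (n q : ℕ) (ν : ℝ) (hν : (n : ℝ) + 1 < ν) :
    -- the orthogonal decomposition of the super Bergman space into Bergman spaces
    (∀ ψ : Finset (Fin q) → (Fin (n + 1) → ℂ) → ℂ,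
      MemSuperBergman V ν ψ ↔ ∀ M, MemBergman V (ν + M.card) (ψ M)) ∧
    (∀ θ ψ : Finset (Fin q) → (Fin (n + 1) → ℂ) → ℂ,
      MemSuperBergman V ν θ → MemSuperBergman V ν ψ →
        superInner V ν θ (superHol ψ) =
          ∑ M, ((Real.Gamma ν / Real.Gamma (ν + M.card) : ℝ) : ℂ) *
            bergmanInner V (ν + M.card) (θ M) (ψ M)) ∧
    -- the matrix of `T_F` for `F = ∑ F_{A,B} ξ_A ξ_B^*`
    (∀ F : Finset (Fin q) → Finset (Fin q) → (Fin (n + 1) → ℂ) → ℂ,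
      (∀ A B, ContinuousOn (F A B) (V.carrier n)) →
      HasToeplitzMatrix V ν (fun z => ∑ A, ∑ B, F A B z • (xi A * xiStar B))
        (fun I J => {K | I ∪ J ⊆ K})
        (fun I J K => (-1) ^ ((K \ I).card * (K \ J).card) * eps (K \ I) I * eps (K \ J) J *
          ((Real.Gamma (ν + I.card - (n + 1)) / Real.Gamma (ν + K.card - (n + 1)) : ℝ) : ℂ))
        (fun I J K z => F (K \ J) (K \ I) z * ((V.rho z ^ (K.card - I.card) : ℝ) : ℂ))) ∧
    -- the matrix of `T_F` for `F = ∑ F_{A,B} ξ_A^* ξ_B`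
    (∀ F : Finset (Fin q) → Finset (Fin q) → (Fin (n + 1) → ℂ) → ℂ,
      (∀ A B, ContinuousOn (F A B) (V.carrier n)) →
      HasToeplitzMatrix V ν (fun z => ∑ A, ∑ B, F A B z • (xiStar A * xi B))
        (fun I J => {K | I ∪ J ⊆ K})
        (fun I J K => eps (K \ I) I * eps (K \ J) J *
          ((Real.Gamma (ν + I.card - (n + 1)) / Real.Gamma (ν + K.card - (n + 1)) : ℝ) : ℂ))
        (fun I J K z => F (K \ I) (K \ J) z * ((V.rho z ^ (K.card - I.card) : ℝ) : ℂ))) ∧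
    -- the matrix is diagonal for `F = ∑ F_M ξ_M ξ_M^*`
    (∀ F : Finset (Fin q) → (Fin (n + 1) → ℂ) → ℂ,
      (∀ M, ContinuousOn (F M) (V.carrier n)) →
      HasToeplitzMatrix V ν (fun z => ∑ M, F M z • (xi M * xiStar M))
        (fun I J => if I = J then Finset.univ.filter (fun K => I ⊆ K) else ∅)
        (fun I _ K => (-1) ^ (K \ I).card *
          ((Real.Gamma (ν + I.card - (n + 1)) / Real.Gamma (ν + K.card - (n + 1)) : ℝ) : ℂ))
        (fun I _ K z => F (K \ I) z * ((V.rho z ^ (K.card - I.card) : ℝ) : ℂ))) ∧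
    -- the matrix is diagonal for `F = ∑ F_M ξ_M^* ξ_M`
    (∀ F : Finset (Fin q) → (Fin (n + 1) → ℂ) → ℂ,
      (∀ M, ContinuousOn (F M) (V.carrier n)) →
      HasToeplitzMatrix V ν (fun z => ∑ M, F M z • (xiStar M * xi M))
        (fun I J => if I = J then Finset.univ.filter (fun K => I ⊆ K) else ∅)
        (fun I _ K => 
          ((Real.Gamma (ν + I.card - (n + 1)) / Real.Gamma (ν + K.card - (n + 1)) : ℝ) : ℂ))
        (fun I _ K z => F (K \ I) z * ((V.rho z ^ (K.card - I.card) : ℝ) : ℂ))) := by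
  exact ⟨memSuperBergman_iff hν, fun _ _ hθ hψ => superInner_superHol hν hθ hψ,
    fun F _ => hasToeplitzMatrix_xi_mul_xiStar hν F,
    fun F _ => hasToeplitzMatrix_xiStar_mul_xi hν F,
    fun F _ => hasToeplitzMatrix_diagonal_xi_mul_xiStar hν F,
    fun F _ => hasToeplitzMatrix_diagonal_xiStar_mul_xi hν F⟩
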